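/- **Setting.** An abelian network $\mathcal N$ on a finite directed multigraph has at each vertex $v$ a processor with finite input alphabet $A_v$, finite nonempty state space $Q_v$, transition functions $T_a : Q_v \to Q_v$ ($a \in A_v$) and, for each edge $e=(v,u)$, a message-passing function $T_e : Q_v \times A_v \to A_u^*$, such that the maps $T_a$, $a\in A_v$, commute and $T_e(q,a)T_e(T_a q,b)$ equals $T_e(q,b)T_e(T_b q,a)$ up to permuting letters. Put $A=\bigsqcup_v A_v$, $Q=\prod_v Q_v$. A configuration is a pair $\mathbf x.\mathbf q$ with $\mathbf x\in\mathbb Z^A$, $\mathbf q \in Q$. Processing $a \in A_v$ sends $\mathbf x.\mathbf q$ to $(\mathbf x+\mathbf N_a(\mathbf q)-|a|).t_a\mathbf q$, where $t_a$ applies $T_a$ at $v$, $\mathbf N_a(\mathbf q)\in\mathbb N^A$ counts the letters sent and $|a|$ is the unit vector of $a$; this step is legal if $\mathbf x(a)\ge 1$. For $\mathbf n \in \mathbb N^A$ let $t_{\mathbf n}$ and $\mathbf N_{\mathbf n}(\mathbf q)$ be the state transition and the letters sent when any word with letter counts $\mathbf n$ is processed. Write $\mathbf x.\mathbf q\to\mathbf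 x'.\mathbf q'$ if a finite, possibly empty, sequence of legal steps leads from the first to the second. Let $\mathrm{Loc}=eQ$, where $e$ is the product of all idempotents of the monoid generated by the maps $t_a$. The total kernel is $K=\{\mathbf z\in\mathbb Z^A : t_{\mathbf z^+}\mathbf q=t_{\mathbf z^-}\mathbf q \ \forall \mathbf q\in\mathrm{Loc}\}$. $\mathcal N$ is locally irreducible if for all $\mathbf q,\mathbf q'\in Q$ there are words $w,w'$ with $t_w\mathbf q=t_{w'}\mathbf q'$; then the production matrix is the unique rational matrix $P$ with $P\mathbf k=\mathbf N_{\mathbf k}(\mathbf q)$ for all $\mathbf k\in K\cap\mathbb N^A$, $\mathbf q\in \mathrm{Loc}$. $\mathcal N$ is strongly connected if the digraph on $A$ with edges $\{(a,b):P_{ba}>0\}$ has exactly one strong component, and critical if the spectral radius of $P$ is $1$. For strongly connected critical $\mathcal N$, the exchange rate vector $\mathbf s$ is the positive integer vector with $\gcd_a\mathbf s(a)=1$ that spans the $1$-eigenspace of $P^\top$. **Components and the torsion group.** Two configurations are legally related if legal steps lead from both to a common configuration; the classes $\overline{\mathbf x.\mathbf q}$ of this equivalence relation are the components. A component is recurrent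 if it contains a walk of legal steps, indexed by $\mathbb Z_{\ge0}$, $\mathbb Z_{\le 0}$ or $\mathbb Z$, in which each letter is processed infinitely often; $\mathrm{Lrec}$ is the set of recurrent components. $\mathbb N^A$ acts on $\mathrm{Lrec}$ by $\phi(\mathbf n)(\overline{\mathbf x.\mathbf q})=\overline{(\mathbf x+\mathbf n).\mathbf q}$. $\mathrm{Tor}(\mathcal N)$ is the torsion subgroup of the Grothendieck group of the monoid $\phi(\mathbb N^A)$. A component $\mathcal C\in\mathrm{Lrec}$ is invertible, $\mathcal C\in\mathrm{Lrec}^\times$, if whenever the class of $(\phi(\mathbf n),\phi(\mathbf n'))$ lies in $\mathrm{Tor}(\mathcal N)$ there is $\mathcal C'\in\mathrm{Lrec}$ with $\phi(\mathbf n)(\mathcal C)=\phi(\mathbf n')(\mathcal C')$; then that class acts by sending $\mathcal C$ to $\mathcal C'$. **Levels.** A configuration halts if legal steps lead from it to some $\mathbf x'.\mathbf q'$ with $\mathbf x'\le 0$. Let $\mathrm{cpt}(\mathbf x.\mathbf q)=\max\{\mathbf s^\top\mathbf z : \mathbf z\in\mathbb Z^A,\ (\mathbf z+\mathbf x).\mathbf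 q\text{ halts}\}$, $\mathrm{cpt}(\mathcal N)=\max_{\mathbf q\in Q}\mathrm{cpt}(\mathbf 0.\mathbf q)$ and $\mathrm{lvl}(\mathbf x.\mathbf q)=\mathrm{cpt}(\mathcal N)-\mathrm{cpt}(\mathbf x.\mathbf q)$. A configuration is recurrent if it admits at least one legal step and is reached by legal steps from every configuration legally related to it. The level of a recurrent component is the level of any recurrent configuration in it, and $\mathrm{Lrec}(m)$ is the set of recurrent components of level $m$. $\mathrm{Stop}(\mathcal N)$ is the set of $m\in\mathbb N=\{0,1,2,\dots\}$ with $m=\mathrm{lvl}(\mathbf x.\mathbf q)$ for some $\mathbf x\le 0$, $\mathbf q\in\mathrm{Loc}$. Let $\mathbb Z^A_0=\{\mathbf z\in\mathbb Z^A:\mathbf s^\top\mathbf z=0\}$. **Theorem.** Let $\mathcal N$ be a finite, locally irreducible, strongly connected, critical abelian network. (i) $(I-P)K\subseteq\mathbb Z^A_0$, and $\phi$ induces an isomorphism of abelian groups $\mathbb Z^A_0/(I-P)K\simeq\mathrm{Tor}(\mathcal N)$, under which the class of $\mathbf n-\mathbf n'\in\mathbb Z^A_0$ ($\mathbf n,\mathbf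 n'\in\mathbb N^A$) corresponds to the class of $(\phi(\mathbf n),\phi(\mathbf n'))$. (ii) $\mathrm{Lrec}^\times=\bigsqcup_{m\in\mathbb N\setminus\mathrm{Stop}(\mathcal N)}\mathrm{Lrec}(m)$, and the sets $\mathrm{Lrec}(m)$, $m\in\mathbb N$, are pairwise disjoint. (iii) The rule above defines a unique group action of $\mathrm{Tor}(\mathcal N)$ on $\mathrm{Lrec}^\times$. For every $m\in\mathbb N\setminus\mathrm{Stop}(\mathcal N)$ the set $\mathrm{Lrec}(m)$ is nonempty, is preserved by this action, and the action of $\mathrm{Tor}(\mathcal N)$ on it is free and transitive. Moreover $\mathrm{Stop}(\mathcal N)$ is finite, so this holds for all but finitely many $m$. -/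

import Mathlib

/-- An abelian network on the directed multigraph with vertex set `V` and with `E v u` the set of
edges from `v` to `u` (self-loops and multiple edges are allowed).  The processor at `v` has input
alphabet `A v` and state space `S v`. -/
structure AbelianNetwork (V : Type*) (E : V → V → Type*) (A : V → Type*) (S : V → Type*) where
  /-- the transition function `T_a` -/
  next : ∀ {v : V}, A v → S v → S v
  /-- the message-passing function `T_e` -/
  msg : ∀ {v u : V}, E v u → S v → A v → List (A u)
  next_comm : ∀ {v : V} (a b : A v) (q : S v), next a (next b q) = next b (next a q)
  msg_comm : ∀ {v u : V} (e : E v u) (a b : A v) (q : S v),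
    (msg e q a ++ msg e (next a q) b).Perm (msg e q b ++ msg e (next b q) a)

namespace AbelianNetwork

/-- The total alphabet, the disjoint union of the alphabets of the processors. -/
abbrev Letter {V : Type*} (A : V → Type*) : Type _ := Σ v, A v

/-- The total state space. -/
abbrev State {V : Type*} (S : V → Type*) : Type _ := ∀ v, S v

/-- A configuration `x.q`: an input vector together with a state. -/
abbrev Config {V : Type*} (A S : V → Type*) : Type _ := (Letter A → ℤ) × State S

noncomputable section

variable {V : Type*} [Fintype V] [DecidableEq V] {E : V → V → Type*} [∀ v u, Fintype (E v u)]
  {A : V → Type*} [∀ v, Fintype (A v)] [∀ v, DecidableEq (A v)]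
  {S : V → Type*} [∀ v, Fintype (S v)]
  (N : AbelianNetwork V E A S)

set_option linter.unusedSectionVars false

/-! ### Transitions -/

/-- The total transition function `t_a`. -/
def t (a : Letter A) (q : State S) : State S := Function.update q a.1 (N.next a.2 (q a.1))

/-- The message-passing vector `N_a(q)`: the entry at `b` counts the letters `b` sent along the
edges from the vertex of `a` to the vertex of `b`. -/
def emit (a : Letter A) (q : State S) (b : Letter A) : ℕ :=
  ∑ e : E a.1 b.1, (N.msg e (q a.1) a.2).count b.2

/-- The state `t_w q` after processing the word `w` from left to right. -/
def tWord : List (Letter A) → State S → State S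
  | [], q => q
  | a :: w, q => tWord w (N.t a q)

/-- The message-passing vector `N_w(q)` of a word. -/
def emitWord : List (Letter A) → State S → Letter A → ℕ
  | [], _ => 0
  | a :: w, q => N.emit a q + emitWord w (N.t a q)

/-- A word in which every letter `a` occurs `n a` times. -/
def wordOf (n : Letter A → ℕ) : List (Letter A) :=
  Finset.univ.toList.flatMap fun a => List.replicate (n a) a

/-- `t_n q` for a vector `n`, through a word that represents `n`. -/
def tVec (n : Letter A → ℕ) (q : State S) : State S := N.tWord (wordOf n) q

/-- `N_n(q)` for a vector `n`, through a word that represents `n`. -/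
def emitVec (n : Letter A → ℕ) (q : State S) : Letter A → ℕ := N.emitWord (wordOf n) q

/-- The configuration transition function `π_a`. -/
def fire (a : Letter A) (c : Config A S) : Config A S :=
  (fun b => c.1 b + N.emit a c.2 b - (Pi.single a 1 : Letter A → ℤ) b, N.t a c.2)

theorem t_comm (a b : Letter A) (q : State S) : N.t a (N.t b q) = N.t b (N.t a q) := by
  rcases a with ⟨v, a⟩
  rcases b with ⟨u, b⟩
  by_cases h : v = u
  · subst h
    simp [t, N.next_comm a b]
  · simp only [t, Function.update_of_ne h, Function.update_of_ne (Ne.symm h)]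
    exact Function.update_comm (Ne.symm h) _ _ _

theorem emit_comm (a b : Letter A) (q : State S) :
    N.emit a q + N.emit b (N.t a q) = N.emit b q + N.emit a (N.t b q) := by
  rcases a with ⟨v, a⟩
  rcases b with ⟨u, b⟩
  funext c
  by_cases h : v = u
  · subst h
    simp only [emit, t, Pi.add_apply, Function.update_self, ← Finset.sum_add_distrib,
      ← List.count_append]
    exact Finset.sum_congr rfl fun e _ => (N.msg_comm e a b (q v)).count_eq _
  · simp [emit, t, Function.update_of_ne h, Function.update_of_ne (Ne.symm h), add_comm]

theorem tWord_perm {w w' : List (Letter A)} (h : w.Perm w') :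
    ∀ q, N.tWord w q = N.tWord w' q := by
  induction h with
  | nil => intro q; rfl
  | cons a _ ih => intro q; exact ih _
  | swap a b l => intro q; simp [tWord, N.t_comm a b]
  | trans _ _ ih1 ih2 => intro q; rw [ih1, ih2]

theorem emitWord_perm {w w' : List (Letter A)} (h : w.Perm w') :
    ∀ q, N.emitWord w q = N.emitWord w' q := by
  induction h with
  | nil => intro q; rfl
  | cons a _ ih => intro q; simp only [emitWord, ih]
  | swap a b l =>
    intro q
    simp only [emitWord, ← add_assoc, N.emit_comm a b, N.t_comm a b]
  | trans _ _ ih1 ih2 => intro q; rw [ih1, ih2]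

theorem tWord_append (w w' : List (Letter A)) (q : State S) :
    N.tWord (w ++ w') q = N.tWord w' (N.tWord w q) := by
  induction w generalizing q with
  | nil => rfl
  | cons a w ih => exact ih _

theorem emitWord_append (w w' : List (Letter A)) (q : State S) :
    N.emitWord (w ++ w') q = N.emitWord w q + N.emitWord w' (N.tWord w q) := by
  induction w generalizing q with
  | nil => simp [emitWord, tWord]
  | cons a w ih => simp [emitWord, tWord, ih, add_assoc]

theorem count_wordOf (n : Letter A → ℕ) (a : Letter A) : (wordOf n).count a = n a := by
  simp [wordOf, List.count_flatMap, Function.comp_def, List.count_replicate]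

theorem tWord_eq_tVec (w : List (Letter A)) (q : State S) :
    N.tWord w q = N.tVec (fun a => w.count a) q :=
  N.tWord_perm (List.perm_iff_count.2 fun a => (count_wordOf (fun a => w.count a) a).symm) q

theorem emitWord_eq_emitVec (w : List (Letter A)) (q : State S) :
    N.emitWord w q = N.emitVec (fun a => w.count a) q :=
  N.emitWord_perm (List.perm_iff_count.2 fun a => (count_wordOf (fun a => w.count a) a).symm) q

theorem wordOf_add (m n : Letter A → ℕ) : (wordOf (m + n)).Perm (wordOf m ++ wordOf n) :=
  List.perm_iff_count.2 fun a => by simp [count_wordOf]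

theorem tVec_add (m n : Letter A → ℕ) (q : State S) :
    N.tVec (m + n) q = N.tVec n (N.tVec m q) := by
  rw [tVec, N.tWord_perm (wordOf_add m n), tWord_append]; rfl

theorem emitVec_add (m n : Letter A → ℕ) (q : State S) :
    N.emitVec (m + n) q = N.emitVec m q + N.emitVec n (N.tVec m q) := by
  rw [emitVec, N.emitWord_perm (wordOf_add m n), emitWord_append]; rfl

theorem tVec_zero (q : State S) : N.tVec 0 q = q := by
  have : (wordOf (0 : Letter A → ℕ)) = [] := by simp [wordOf]
  simp [tVec, this, tWord]

theorem emitVec_zero (q : State S) : N.emitVec 0 q = 0 := by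
  have : (wordOf (0 : Letter A → ℕ)) = [] := by simp [wordOf]
  simp [emitVec, this, emitWord]

/-! ### Locally recurrent states -/

/-- The transition monoid, the submonoid of `End(Q)` generated by the maps `t_a`. -/
def transMonoid : Submonoid (Function.End (State S)) :=
  Submonoid.closure (Set.range fun a : Letter A => (N.t a : Function.End (State S)))

instance : CommMonoid N.transMonoid :=
  { (inferInstance : Monoid N.transMonoid) with
    mul_comm := (Submonoid.isMulCommutative_closure _ (by
      rintro _ ⟨a, rfl⟩ _ ⟨b, rfl⟩
      exact funext fun q => N.t_comm a b q)).is_comm.comm }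

/-- The minimal idempotent of the (finite, commutative) transition monoid: the product of all its
idempotents. -/
def minIdem : N.transMonoid := ∏ᶠ (f : N.transMonoid) (_ : IsIdempotentElem f), f

/-- The set `Loc(N) = eQ` of locally recurrent states, `e` the minimal idempotent. -/
def Loc : Set (State S) := Set.range (N.minIdem.1 : State S → State S)

theorem finite_transMonoid : Finite N.transMonoid := by
  have : Finite (Function.End (State S)) := inferInstanceAs (Finite (State S → State S))
  infer_instance

theorem idem_mul_minIdem (f : N.transMonoid) (hf : IsIdempotentElem f) :
    f * N.minIdem = N.minIdem := by
  classical
  have := N.finite_transMonoid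
  have h : N.minIdem = ∏ g ∈ (Set.toFinite {g : N.transMonoid | IsIdempotentElem g}).toFinset, g :=
    finprod_mem_eq_finite_toFinset_prod _ _
  have hmem : f ∈ (Set.toFinite {g : N.transMonoid | IsIdempotentElem g}).toFinset := by
    simpa using hf
  rw [h, ← Finset.mul_prod_erase _ _ hmem, ← mul_assoc, hf.eq]

theorem exists_mul_minIdem (m : N.transMonoid) : ∃ m' : N.transMonoid,
    m' * m * N.minIdem = N.minIdem := by
  have := N.finite_transMonoid
  obtain ⟨i, j, hij, h⟩ := Finite.exists_ne_map_eq_of_infinite fun k : ℕ => m ^ k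
  wlog hlt : i < j generalizing i j
  · exact this j i hij.symm h.symm (by omega)
  obtain ⟨p, rfl⟩ : ∃ p, j = i + (p + 1) := ⟨j - i - 1, by omega⟩
  have key : ∀ k l, m ^ (i + k) = m ^ (i + k + l * (p + 1)) := by
    intro k l
    induction l with
    | zero => simp
    | succ l ih =>
      have h' : m ^ i = m ^ (i + (p + 1)) := h
      rw [ih, show i + k + l * (p + 1) = i + (k + l * (p + 1)) by ring, pow_add, h', ← pow_add]
      congr 1; ring
  have hid : IsIdempotentElem (m ^ ((i + 1) * (p + 1))) := by
    rw [IsIdempotentElem, ← pow_add]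
    have := key ((i + 1) * (p + 1) - i) (i + 1)
    have hle : i ≤ (i + 1) * (p + 1) := by nlinarith
    rw [Nat.add_sub_cancel' hle] at this
    exact this.symm
  refine ⟨m ^ ((i + 1) * (p + 1) - 1), ?_⟩
  rw [← pow_succ, Nat.sub_add_cancel (by nlinarith)]
  exact N.idem_mul_minIdem _ hid

theorem tWord_mem (w : List (Letter A)) :
    (N.tWord w : Function.End (State S)) ∈ N.transMonoid := by
  induction w with
  | nil => exact N.transMonoid.one_mem
  | cons a w ih => exact N.transMonoid.mul_mem ih (Submonoid.subset_closure ⟨a, rfl⟩)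

theorem tVec_mem_Loc (n : Letter A → ℕ) {q : State S} (hq : q ∈ N.Loc) : N.tVec n q ∈ N.Loc := by
  obtain ⟨p, rfl⟩ := hq
  have h := mul_comm (⟨_, N.tWord_mem (wordOf n)⟩ : N.transMonoid) N.minIdem
  exact ⟨N.tVec n p, (congrFun (congrArg Subtype.val h) p).symm⟩

theorem tVec_injOn_Loc (n : Letter A → ℕ) : Set.InjOn (N.tVec n) N.Loc := by
  rintro _ ⟨p, rfl⟩ _ ⟨p', rfl⟩ h
  obtain ⟨m', hm'⟩ := N.exists_mul_minIdem ⟨_, N.tWord_mem (wordOf n)⟩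
  have e : ∀ p, (N.minIdem.1 : State S → State S) p =
      (m'.1 : State S → State S) (N.tVec n ((N.minIdem.1 : State S → State S) p)) := fun p =>
    (congrFun (congrArg Subtype.val hm') p).symm
  rw [e p, e p', h]

theorem Loc_nonempty [∀ v, Nonempty (S v)] : N.Loc.Nonempty := Set.range_nonempty _

/-! ### The total kernel and the production matrix -/

/-- The positive part of an integer vector. -/
def posPart (z : Letter A → ℤ) : Letter A → ℕ := fun a => (z a).toNat

/-- The negative part of an integer vector. -/
def negPart (z : Letter A → ℤ) : Letter A → ℕ := fun a => (-z a).toNat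

/-- The vector `n` in `ℕ^A`, seen in `ℤ^A`. -/
def natVec (n : Letter A → ℕ) : Letter A → ℤ := fun a => n a

theorem tVec_eq_of_sub_eq {n n' m m' : Letter A → ℕ} (h : n + m' = n' + m)
    (hm : ∀ q ∈ N.Loc, N.tVec m q = N.tVec m' q) :
    ∀ q ∈ N.Loc, N.tVec n q = N.tVec n' q := by
  intro q hq
  apply N.tVec_injOn_Loc m' (N.tVec_mem_Loc n hq) (N.tVec_mem_Loc n' hq)
  rw [← tVec_add, h, tVec_add, hm _ (N.tVec_mem_Loc n' hq)]

/-- The total kernel `K`. -/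
def totalKernel : AddSubgroup (Letter A → ℤ) where
  carrier := {z | ∀ q ∈ N.Loc, N.tVec (posPart z) q = N.tVec (negPart z) q}
  zero_mem' := fun q _ => rfl
  neg_mem' := by
    intro z hz q hq
    have h1 : posPart (-z) = negPart z := rfl
    have h2 : negPart (-z) = posPart z := by funext a; simp [negPart, posPart]
    rw [h1, h2]
    exact (hz q hq).symm
  add_mem' := by
    intro z z' hz hz'
    refine N.tVec_eq_of_sub_eq (m := posPart z + posPart z') (m' := negPart z + negPart z') ?_ ?_
    · funext a
      simp only [posPart, negPart, Pi.add_apply]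
      omega
    · intro q hq
      rw [tVec_add, tVec_add, hz q hq, hz' _ (N.tVec_mem_Loc _ hq)]

theorem natVec_mem_totalKernel (n : Letter A → ℕ) :
    natVec n ∈ N.totalKernel ↔ ∀ q ∈ N.Loc, N.tVec n q = q := by
  have h1 : posPart (natVec n) = n := by funext a; simp [posPart, natVec]
  have h2 : negPart (natVec n) = 0 := by funext a; simp [negPart, natVec]
  have : natVec n ∈ N.totalKernel ↔
      ∀ q ∈ N.Loc, N.tVec (posPart (natVec n)) q = N.tVec (negPart (natVec n)) q := Iff.rfl
  rw [this, h1, h2]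
  simp only [tVec_zero]

/-- Any two states can be brought to a common state. -/
def LocallyIrreducible : Prop :=
  ∀ q q' : State S, ∃ w w' : List (Letter A), N.tWord w q = N.tWord w' q'

/-- `P` is the matrix of the rational linear extension of `k ↦ N_k(q)`, `k ∈ K ∩ ℕ^A`, for every
locally recurrent state `q`. -/
def IsProductionMatrix (P : Matrix (Letter A) (Letter A) ℚ) : Prop :=
  ∀ q ∈ N.Loc, ∀ k : Letter A → ℕ, natVec k ∈ N.totalKernel →
    P.mulVec (fun a => (k a : ℚ)) = fun b => (N.emitVec k q b : ℚ)

/-- The vectors of `K ∩ ℕ^A`. -/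
def fixing : AddSubmonoid (Letter A → ℕ) where
  carrier := {k | ∀ q ∈ N.Loc, N.tVec k q = q}
  zero_mem' := fun q _ => N.tVec_zero q
  add_mem' := fun {k l} hk hl q hq => by rw [tVec_add, hk q hq, hl q hq]

/-- The homomorphism `k ↦ N_k(q)` on `K ∩ ℕ^A`. -/
def emitHom (q : State S) (hq : q ∈ N.Loc) : N.fixing →+ (Letter A → ℕ) where
  toFun k := N.emitVec k.1 q
  map_zero' := N.emitVec_zero q
  map_add' k l := by
    change N.emitVec (k.1 + l.1) q = _
    rw [emitVec_add, k.2 q hq]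

theorem emitVec_const (hN : N.LocallyIrreducible) {q q' : State S} (hq : q ∈ N.Loc)
    (hq' : q' ∈ N.Loc) {k : Letter A → ℕ} (hk : k ∈ N.fixing) :
    N.emitVec k q = N.emitVec k q' := by
  have key : ∀ (m : Letter A → ℕ) (p : State S), p ∈ N.Loc →
      N.emitVec k (N.tVec m p) = N.emitVec k p := by
    intro m p hp
    have h1 := N.emitVec_add k m p
    have h2 := N.emitVec_add m k p
    rw [add_comm m k, h1, hk p hp, add_comm] at h2
    exact (add_left_cancel h2).symm
  obtain ⟨w, w', h⟩ := hN q q'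
  rw [tWord_eq_tVec, tWord_eq_tVec] at h
  rw [← key _ q hq, h, key _ q' hq']

theorem exists_single_mem_fixing (a : Letter A) : ∃ d : ℕ, 0 < d ∧ Pi.single a d ∈ N.fixing := by
  obtain ⟨i, j, hij, h⟩ := Finite.exists_ne_map_eq_of_infinite
    fun k : ℕ => fun q : State S => N.tVec (Pi.single a k) q
  wlog hlt : i < j generalizing i j
  · exact this j i hij.symm h.symm (by omega)
  refine ⟨j - i, by omega, fun q hq => ?_⟩
  apply N.tVec_injOn_Loc (Pi.single a i) (N.tVec_mem_Loc _ hq) hq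
  rw [← tVec_add, ← Pi.single_add, Nat.sub_add_cancel hlt.le]
  exact (congrFun h q).symm

theorem existsUnique_isProductionMatrix [∀ v, Nonempty (S v)] (hN : N.LocallyIrreducible) :
    ∃! P, N.IsProductionMatrix P := by
  choose d hd hmem using N.exists_single_mem_fixing
  obtain ⟨q₀, hq₀⟩ := N.Loc_nonempty
  have hd' : ∀ a, (d a : ℚ) ≠ 0 := fun a => by exact_mod_cast (hd a).ne'
  refine ⟨fun b a => N.emitVec (Pi.single a (d a)) q₀ b / d a, ?_, ?_⟩
  · intro q hq k hk
    have hk' : k ∈ N.fixing := (N.natVec_mem_totalKernel k).1 hk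
    rw [N.emitVec_const hN hq hq₀ hk']
    let D : ℕ := ∏ a, d a
    have hD : (D : ℚ) ≠ 0 := by
      have : D ≠ 0 := Finset.prod_ne_zero_iff.2 fun a _ => (hd a).ne'
      exact_mod_cast this
    have hdiv : ∀ a, d a ∣ D := fun a => Finset.dvd_prod_of_mem _ (Finset.mem_univ a)
    let u : Letter A → N.fixing := fun a => ⟨Pi.single a (d a), hmem a⟩
    have hsum : D • (⟨k, hk'⟩ : N.fixing) = ∑ a, (D / d a * k a) • u a := by
      apply Subtype.ext
      funext b
      rw [AddSubmonoid.coe_finsetSum, Finset.sum_apply, Finset.sum_eq_single b]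
      · have h1 : ((D • (⟨k, hk'⟩ : N.fixing) : N.fixing) : Letter A → ℕ) b = D * k b := by simp
        have h2 : (((D / d b * k b) • u b : N.fixing) : Letter A → ℕ) b = D / d b * k b * d b := by
          simp [u]
        rw [h1, h2, mul_right_comm, Nat.div_mul_cancel (hdiv b)]
      · intro a _ hab
        simp [u, Pi.single_eq_of_ne hab.symm]
      · simp
    have h := congrArg (N.emitHom q₀ hq₀) hsum
    rw [map_nsmul, map_sum] at h
    simp only [map_nsmul] at h
    funext b
    have hb : (D : ℚ) * N.emitVec k q₀ b =
        ∑ a, (D / d a * k a : ℚ) * N.emitVec (Pi.single a (d a)) q₀ b := by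
      have := congrFun h b
      simp only [Pi.smul_apply, Finset.sum_apply, smul_eq_mul] at this
      have this' := congrArg (Nat.cast (R := ℚ)) this
      push_cast [Nat.cast_div (hdiv _) (hd' _)] at this'
      exact this'
    apply mul_left_cancel₀ hD
    rw [hb]
    simp only [Matrix.mulVec, dotProduct, Finset.mul_sum]
    exact Finset.sum_congr rfl fun a _ => by field_simp
  · intro P hP
    ext b a
    have h := congrFun (hP q₀ hq₀ _ ((N.natVec_mem_totalKernel _).2 (hmem a))) b
    have hs : (fun c => ((Pi.single a (d a) : Letter A → ℕ) c : ℚ)) = Pi.single a (d a : ℚ) := by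
      funext c
      by_cases hc : c = a
      · subst hc; simp
      · simp [Pi.single_eq_of_ne hc]
    rw [hs, Matrix.mulVec_single] at h
    rw [← h]
    simp [hd' a]

/-- The production matrix of a locally irreducible network: the unique `P` with
`IsProductionMatrix P`. -/
def productionMatrix : Matrix (Letter A) (Letter A) ℚ := Classical.epsilon N.IsProductionMatrix

theorem isProductionMatrix_productionMatrix [∀ v, Nonempty (S v)] (hN : N.LocallyIrreducible) :
    N.IsProductionMatrix N.productionMatrix :=
  Classical.epsilon_spec (N.existsUnique_isProductionMatrix hN).exists

/-- The subgroup `(I - P) K` of `ℤ^A`. -/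
def subgroupIP : AddSubgroup (Letter A → ℤ) where
  carrier := {z | ∃ k ∈ N.totalKernel,
    (fun a => (z a : ℚ)) = (1 - N.productionMatrix).mulVec fun a => (k a : ℚ)}
  zero_mem' := ⟨0, N.totalKernel.zero_mem, by ext a; simp [Matrix.mulVec, dotProduct]⟩
  neg_mem' := by
    rintro z ⟨k, hk, h⟩
    refine ⟨-k, N.totalKernel.neg_mem hk, ?_⟩
    have e : (fun a => ((-k) a : ℚ)) = -fun a => (k a : ℚ) := rfl
    funext a
    have := congrFun h a
    simp only [Pi.neg_apply, Int.cast_neg] at *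
    rw [this]
    exact (congrFun (Matrix.mulVec_neg (fun a => (k a : ℚ)) (1 - N.productionMatrix)) a).symm
  add_mem' := by
    rintro z z' ⟨k, hk, h⟩ ⟨k', hk', h'⟩
    refine ⟨k + k', N.totalKernel.add_mem hk hk', ?_⟩
    funext a
    have h1 := congrFun h a
    have h2 := congrFun h' a
    simp only [Pi.add_apply, Int.cast_add] at *
    rw [h1, h2]
    exact (congrFun (Matrix.mulVec_add (1 - N.productionMatrix) (fun a => (k a : ℚ))
      (fun a => (k' a : ℚ))) a).symm

/-- The production digraph, with an edge `(a, b)` whenever `P_{ba} > 0`, has exactly one strong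
component. -/
def StronglyConnected : Prop :=
  Nonempty (Letter A) ∧
    ∀ a b : Letter A, Relation.ReflTransGen (fun a b => 0 < N.productionMatrix b a) a b

/-- The network is critical: the spectral radius `λ(P)` of the production matrix is `1`. -/
def Critical : Prop := spectralRadius ℂ (N.productionMatrix.map (algebraMap ℚ ℂ)) = 1

/-! ### Components of the trajectory digraph -/

/-- The edge of the trajectory digraph labelled `a`: a legal processing of the letter `a`. -/
def Step (a : Letter A) (c c' : Config A S) : Prop := 1 ≤ c.1 a ∧ c' = N.fire a c

/-- There is a legal execution from `c` to `c'`. -/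
def Reaches : Config A S → Config A S → Prop :=
  Relation.ReflTransGen fun c c' => ∃ a, N.Step a c c'

/-- The legal relation: there are legal executions from both configurations to a common one. -/
def LegallyRelated (c c' : Config A S) : Prop := ∃ d, N.Reaches c d ∧ N.Reaches c' d

theorem fire_comm (a b : Letter A) (c : Config A S) :
    N.fire a (N.fire b c) = N.fire b (N.fire a c) := by
  refine Prod.ext (funext fun l => ?_) (N.t_comm a b c.2)
  have h := congrFun (N.emit_comm a b c.2) l
  simp only [Pi.add_apply] at h
  simp only [fire]
  omega

theorem Step.fire {a b : Letter A} (hab : a ≠ b) {c c' : Config A S} (h : N.Step a c c') :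
    N.Step a (N.fire b c) (N.fire b c') := by
  refine ⟨?_, by rw [h.2, fire_comm]⟩
  have h1 := h.1
  have h2 : (Pi.single b 1 : Letter A → ℤ) a = 0 := Pi.single_eq_of_ne hab 1
  simp only [AbelianNetwork.fire, h2]
  omega

theorem legallyRelated_equivalence : Equivalence N.LegallyRelated := by
  refine Relation.equivalence_join_reflTransGen ?_
  rintro c d e ⟨a, ha⟩ ⟨b, hb⟩
  by_cases hab : a = b
  · subst hab
    rw [ha.2, hb.2]
    exact ⟨_, Relation.ReflGen.refl, Relation.ReflTransGen.refl⟩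
  · refine ⟨N.fire b d, Relation.ReflGen.single ⟨b, ?_⟩, Relation.ReflTransGen.single ⟨a, ?_⟩⟩
    · rw [ha.2]
      have h := Step.fire N (Ne.symm hab) hb
      exact ⟨h.1, rfl⟩
    · rw [hb.2]
      exact Step.fire N hab ha

/-- The components of the trajectory digraph: the classes of the legal relation. -/
def Component : Type _ := Quotient (⟨N.LegallyRelated, N.legallyRelated_equivalence⟩ : Setoid _)

/-- The component of a configuration. -/
def comp (c : Config A S) : N.Component :=
  Quotient.mk (⟨N.LegallyRelated, N.legallyRelated_equivalence⟩ : Setoid _) c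

/-- The component `C` contains a diverse infinite walk: one in which every letter is processed at
infinitely many times, and which is indexed by `ℤ_{≥ 0}` (a forward walk), by `ℤ_{≤ 0}` (a backward
walk) or by `ℤ`. -/
def IsRecurrentComponent (C : N.Component) : Prop :=
  (∃ (c : ℕ → Config A S) (l : ℕ → Letter A), (∀ i, N.Step (l i) (c i) (c (i + 1))) ∧
    (∀ a, {i | l i = a}.Infinite) ∧ ∀ i, N.comp (c i) = C) ∨
  (∃ (c : ℕ → Config A S) (l : ℕ → Letter A), (∀ i, N.Step (l i) (c (i + 1)) (c i)) ∧
    (∀ a, {i | l i = a}.Infinite) ∧ ∀ i, N.comp (c i) = C) ∨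
  (∃ (c : ℤ → Config A S) (l : ℤ → Letter A), (∀ i, N.Step (l i) (c i) (c (i + 1))) ∧
    (∀ a, {i | l i = a}.Infinite) ∧ ∀ i, N.comp (c i) = C)

/-- The set of recurrent components. -/
abbrev Lrec : Type _ := {C : N.Component // N.IsRecurrentComponent C}

/-! ### The shift monoid and the torsion group -/

/-- The configuration `(x + n).q`. -/
def addInput (n : Letter A → ℕ) (c : Config A S) : Config A S := (fun a => c.1 a + n a, c.2)

theorem Step.addInput {a : Letter A} (n : Letter A → ℕ) {c c' : Config A S} (h : N.Step a c c') :
    N.Step a (AbelianNetwork.addInput n c) (AbelianNetwork.addInput n c') := by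
  refine ⟨?_, ?_⟩
  · have := h.1
    simp only [AbelianNetwork.addInput]
    omega
  · rw [h.2]
    refine Prod.ext (funext fun b => ?_) rfl
    simp only [AbelianNetwork.addInput, AbelianNetwork.fire]
    omega

theorem LegallyRelated.addInput (n : Letter A → ℕ) {c c' : Config A S}
    (h : N.LegallyRelated c c') :
    N.LegallyRelated (AbelianNetwork.addInput n c) (AbelianNetwork.addInput n c') := by
  obtain ⟨d, h1, h2⟩ := h
  have key : ∀ {c c'}, N.Reaches c c' →
      N.Reaches (AbelianNetwork.addInput n c) (AbelianNetwork.addInput n c') := by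
    intro c c' hr
    induction hr with
    | refl => exact Relation.ReflTransGen.refl
    | tail _ h ih =>
      obtain ⟨a, ha⟩ := h
      exact ih.tail ⟨a, Step.addInput N n ha⟩
  exact ⟨_, key h1, key h2⟩

/-- The shift of components by `n`, sending the component of `x.q` to that of `(x + n).q`. -/
def shiftComp (n : Letter A → ℕ) : N.Component → N.Component :=
  Quotient.map (addInput n) fun _ _ h => LegallyRelated.addInput N n h

theorem IsRecurrentComponent.shift (n : Letter A → ℕ) {C : N.Component}
    (h : N.IsRecurrentComponent C) : N.IsRecurrentComponent (N.shiftComp n C) := by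
  rcases h with ⟨c, l, h1, h2, h3⟩ | ⟨c, l, h1, h2, h3⟩ | ⟨c, l, h1, h2, h3⟩
  · exact Or.inl ⟨fun i => addInput n (c i), l, fun i => Step.addInput N n (h1 i), h2,
      fun i => by rw [← h3 i]; rfl⟩
  · exact Or.inr (Or.inl ⟨fun i => addInput n (c i), l, fun i => Step.addInput N n (h1 i), h2,
      fun i => by rw [← h3 i]; rfl⟩)
  · exact Or.inr (Or.inr ⟨fun i => addInput n (c i), l, fun i => Step.addInput N n (h1 i), h2,
      fun i => by rw [← h3 i]; rfl⟩)

/-- The action `φ : ℕ^A → End(Lrec)`. -/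
def phi : Multiplicative (Letter A → ℕ) →* Function.End N.Lrec where
  toFun n := fun C => ⟨N.shiftComp n.toAdd C.1, C.2.shift N n.toAdd⟩
  map_one' := by
    funext ⟨C, hC⟩
    induction C using Quotient.ind with
    | _ c =>
      refine Subtype.ext (congrArg (Quotient.mk _) (?_ : addInput 0 c = c))
      exact Prod.ext (funext fun a => by simp [addInput]) rfl
  map_mul' := by
    rintro m n
    funext ⟨C, hC⟩
    induction C using Quotient.ind with
    | _ c =>
      refine Subtype.ext (congrArg (Quotient.mk _)
        (?_ : addInput (m.toAdd + n.toAdd) c = addInput m.toAdd (addInput n.toAdd c)))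
      exact Prod.ext (funext fun a => by simp only [addInput, Pi.add_apply]; push_cast; ring) rfl

/-- The shift monoid `φ(ℕ^A)`. -/
abbrev Mon : Submonoid (Function.End N.Lrec) := MonoidHom.mrange N.phi

instance : CommMonoid N.Mon :=
  { (inferInstance : Monoid N.Mon) with
    mul_comm := by
      rintro ⟨_, m, rfl⟩ ⟨_, n, rfl⟩
      exact Subtype.ext (by
        change N.phi m * N.phi n = N.phi n * N.phi m
        rw [← map_mul, mul_comm, map_mul]) }

/-- The element `φ(n)` of the shift monoid. -/
def shift (n : Letter A → ℕ) : N.Mon := ⟨N.phi (Multiplicative.ofAdd n), _, rfl⟩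

/-- The Grothendieck group of the shift monoid. -/
abbrev Grt : Type _ := Algebra.GrothendieckGroup N.Mon

/-- The class of the pair `(φ(n), φ(n'))` in the Grothendieck group of the shift monoid. -/
def frac (n n' : Letter A → ℕ) : N.Grt := Localization.mk (N.shift n) ⟨N.shift n', trivial⟩

/-- The torsion group: the torsion subgroup of the Grothendieck group of the shift monoid. -/
abbrev Tor : Subgroup N.Grt := CommGroup.torsion N.Grt

/-- A recurrent component `C` is invertible if for every element of the torsion group, and every
way of writing it as the class of `(φ(n), φ(n'))`, there is a recurrent component `C'` with
`φ(n)(C) = φ(n')(C')`. -/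
def Invertible (C : N.Lrec) : Prop :=
  ∀ g ∈ N.Tor, ∀ n n' : Letter A → ℕ, g = N.frac n n' →
    ∃ C' : N.Lrec, (N.shift n).1 C = (N.shift n').1 C'

/-- The set of invertible recurrent components. -/
abbrev InvLrec : Type _ := {C : N.Lrec // N.Invertible C}

/-- The group action is the action of the torsion group on the invertible recurrent components:
if `g` is the class of `(φ(n), φ(n'))`, then `g • C` is the `C'` with `φ(n)(C) = φ(n')(C')`. -/
def IsTorAction (act : MulAction N.Tor N.InvLrec) : Prop :=
  ∀ (g : N.Tor) (C : N.InvLrec) (n n' : Letter A → ℕ), (g : N.Grt) = N.frac n n' →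
    (N.shift n).1 C.1 = (N.shift n').1 (act.smul g C).1

/-! ### Levels in a critical network -/

/-- `s` is a positive integer vector with coprime entries that spans the eigenspace of the transpose
of `P` for the eigenvalue `λ(Pᵀ)`. -/
def IsExchangeRate (s : Letter A → ℤ) : Prop :=
  (∀ a, 0 < s a) ∧ Finset.univ.gcd s = 1 ∧
    Module.End.eigenspace (Matrix.toLin' (N.productionMatrix.transpose.map (algebraMap ℚ ℝ)))
        (spectralRadius ℂ (N.productionMatrix.transpose.map (algebraMap ℚ ℂ))).toReal =
      Submodule.span ℝ {fun a => (s a : ℝ)}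

/-- The exchange rate vector of a strongly connected critical network: the unique `s` with
`IsExchangeRate s`. -/
def exchangeRate : Letter A → ℤ := Classical.epsilon N.IsExchangeRate

/-- The value `sᵀ z`. -/
def weight (z : Letter A → ℤ) : ℤ := ∑ a, N.exchangeRate a * z a

/-- The subgroup `ℤ^A_0` of the vectors `z` with `sᵀ z = 0`. -/
def zeroWeight : AddSubgroup (Letter A → ℤ) where
  carrier := {z | N.weight z = 0}
  zero_mem' := by simp [weight]
  add_mem' := by
    intro z z' hz hz'
    simp only [weight, Set.mem_ofPred_eq, Pi.add_apply, mul_add, Finset.sum_add_distrib] at *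
    rw [hz, hz', add_zero]
  neg_mem' := by
    intro z hz
    simp only [weight, Set.mem_ofPred_eq, Pi.neg_apply, mul_neg, Finset.sum_neg_distrib] at *
    rw [hz, neg_zero]

/-- The configuration halts: some legal execution leads to a configuration without letters to
process. -/
def Halts (c : Config A S) : Prop := ∃ c', N.Reaches c c' ∧ ∀ a, c'.1 a ≤ 0

/-- The capacity of a configuration `x.q`: the maximum of `sᵀ z` over all `z` such that `(x + z).q`
halts.  In a strongly connected critical network these integers form a nonempty set that is bounded
above, so that the supremum is a maximum. -/
def cpt (c : Config A S) : ℤ :=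
  sSup {m | ∃ z : Letter A → ℤ, N.Halts (z + c.1, c.2) ∧ N.weight z = m}

/-- The capacity of the network: the maximum of the capacities of its states. -/
def netCpt : ℤ := ⨆ q : State S, N.cpt (0, q)

/-- The level of a configuration. -/
def lvl (c : Config A S) : ℤ := N.netCpt - N.cpt c

/-- A configuration of a critical network is recurrent if it has a nonempty legal execution and can
be reached by a legal execution from every configuration that is legally related to it. -/
def IsRecurrentConfig (c : Config A S) : Prop :=
  (∃ a c', N.Step a c c') ∧ ∀ c', N.LegallyRelated c c' → N.Reaches c' c

/-- The recurrent components of level `m`, where the level of a recurrent component is the level of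
any recurrent configuration in it. -/
def LrecLevel (m : ℕ) : Set N.Lrec :=
  {C | ∃ c, N.IsRecurrentConfig c ∧ N.comp c = C.1 ∧ N.lvl c = m}

/-- The set of stoppable levels. -/
def Stop : Set ℕ :=
  {m | ∃ c : Config A S, (∀ a, c.1 a ≤ 0) ∧ c.2 ∈ N.Loc ∧ N.lvl c = m}

end

end AbelianNetwork

/-! Fix a locally recurrent state `q₀` and read everything in the group `ℤ^A / (I - P)K`. Every
recurrent component contains a nonhalting configuration `x.q₀`, every nonhalting `x.q₀` lies in a
recurrent component, and two of them share a component exactly if they differ by an element of `(I -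
P)K` (`exists_comp_eq`, `isRecurrentComponent_comp`, `comp_eq_iff_sub_mem`). So recurrent components
are the nonhalting classes, and `φ(n)` is translation by `n` (`shift_eq_iff`).

The theorem then becomes algebra. The shift monoid is the image of `ℕ^A` in this group, hence
cancellative, and its Grothendieck group is the whole quotient. The functional `sᵀ` kills `(I -
P)K`, and over `ℚ` the image of `I - P` is all of `ker sᵀ`, because the left 1-eigenspace of `P` is
the line of `s`. Hence the torsion is `ℤ^A_0 / (I - P)K` (`frac_mem_tor_iff`). A component is
invertible exactly if the full coset of its coordinate modulo `ℤ^A_0` is nonhalting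
(`invertible_iff_not_halts`). The level of `x.q₀` is a constant plus `sᵀx`, so such a coset is a
level set, and it contains a halting vector exactly if the level is stoppable (`mem_stop_iff`). On
an unstoppable level the torsion group translates a full coset of itself, freely and transitively.

Two inputs link this to the dynamics. The removal lemma `Run.diff` gives the least action principle:
illegal processing neither helps to halt (`Halts.of_fireWord`) nor, in the absence of halting,
leaves the component (`legallyRelated_fireWord`). Perron–Frobenius theory gives the positive left
vector `s` and a positive right vector `r` with `P r = r`. Through `s` the weight varies boundedly
along words, so a legal walk from a given configuration stays in a finite set and must repeat;
irreducibility forces a closed walk to use every letter, which makes its configurations recurrent.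
Through `r` every word is invertible on locally recurrent configurations (`exists_inverse`), so
halting and level are invariant there. -/

namespace Matrix

/-! ### Perron–Frobenius theory for irreducible nonnegative matrices -/

section PerronFrobenius

variable {ι : Type*} [Fintype ι]

/-- A nonnegative vector with `B v = v` that is positive somewhere is positive everywhere, if `B` is
an irreducible nonnegative matrix. -/
theorem pos_of_mulVec_eq_self {R : Type*} [CommRing R] [LinearOrder R] [IsStrictOrderedRing R]
    {B : Matrix ι ι R} (hB : ∀ i j, 0 ≤ B i j)
    (hirr : ∀ a b, Relation.ReflTransGen (fun a b => 0 < B b a) a b)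
    {v : ι → R} (hv : ∀ i, 0 ≤ v i) (hfix : B *ᵥ v = v) {a : ι} (ha : 0 < v a) (b : ι) :
    0 < v b := by
  induction hirr a b with
  | refl => exact ha
  | @tail b c _ h ih =>
    rw [← hfix]
    exact Finset.sum_pos' (fun i _ => mul_nonneg (hB _ _) (hv i)) ⟨b, Finset.mem_univ _, mul_pos h ih⟩

variable [DecidableEq ι]

/-- Powers of `1 + B` eventually spread a nonzero nonnegative vector over all coordinates. -/
theorem exists_one_add_pow_mulVec_pos {B : Matrix ι ι ℝ} (hB : ∀ i j, 0 ≤ B i j)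
    (hirr : ∀ a b, Relation.ReflTransGen (fun a b => 0 < B b a) a b)
    {v : ι → ℝ} (hv : ∀ i, 0 ≤ v i) {a : ι} (ha : 0 < v a) :
    ∃ n : ℕ, ∀ b, 0 < (((1 + B) ^ n) *ᵥ v) b := by
  have hnn : ∀ n : ℕ, ∀ b, 0 ≤ (((1 + B) ^ n) *ᵥ v) b := by
    intro n
    induction n with
    | zero => simpa using hv
    | succ n ih =>
      intro b
      rw [pow_succ', ← mulVec_mulVec, add_mulVec, one_mulVec]
      exact add_nonneg (ih b) (Finset.sum_nonneg fun i _ => mul_nonneg (hB _ _) (ih i))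
  have hstep : ∀ n b, (((1 + B) ^ n) *ᵥ v) b ≤ (((1 + B) ^ (n + 1)) *ᵥ v) b := by
    intro n b
    rw [pow_succ' (1 + B) n, ← mulVec_mulVec, add_mulVec, one_mulVec]
    exact le_add_of_nonneg_right (Finset.sum_nonneg fun i _ => mul_nonneg (hB _ _) (hnn n i))
  have hmono : ∀ b, Monotone fun n : ℕ => (((1 + B) ^ n) *ᵥ v) b := fun b =>
    monotone_nat_of_le_succ fun n => hstep n b
  have hex : ∀ b, ∃ n : ℕ, 0 < (((1 + B) ^ n) *ᵥ v) b := by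
    intro b
    induction hirr a b with
    | refl => exact ⟨0, by simpa using ha⟩
    | @tail b c _ h ih =>
      obtain ⟨n, hn⟩ := ih
      refine ⟨n + 1, ?_⟩
      rw [pow_succ', ← mulVec_mulVec, add_mulVec, one_mulVec]
      exact add_pos_of_nonneg_of_pos (hnn n c) (Finset.sum_pos'
        (fun i _ => mul_nonneg (hB _ _) (hnn n i)) ⟨b, Finset.mem_univ _, mul_pos h hn⟩)
  choose n hn using hex
  exact ⟨Finset.univ.sup n, fun b => (hn b).trans_le (hmono b (Finset.le_sup (Finset.mem_univ b)))⟩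

/-- A nonnegative matrix is monotone on vectors, so the inequality can be iterated. -/
theorem pow_mulVec_ge {B : Matrix ι ι ℝ} (hB : ∀ i j, 0 ≤ B i j) {w : ι → ℝ} {μ : ℝ} (hμ : 0 ≤ μ)
    (h : ∀ i, μ * w i ≤ (B *ᵥ w) i) (n : ℕ) (i : ι) : μ ^ n * w i ≤ ((B ^ n) *ᵥ w) i := by
  induction n generalizing i with
  | zero => simp
  | succ n ih =>
    rw [pow_succ' B, ← mulVec_mulVec]
    calc μ ^ (n + 1) * w i = μ ^ n * (μ * w i) := by ring
      _ ≤ μ ^ n * (B *ᵥ w) i := by gcongr; exact h i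
      _ = ∑ j, B i j * (μ ^ n * w j) := by
        simp only [mulVec, dotProduct, Finset.mul_sum]
        exact Finset.sum_congr rfl fun j _ => by ring
      _ ≤ _ := Finset.sum_le_sum fun j _ => mul_le_mul_of_nonneg_left (ih j) (hB i j)

section Norm

attribute [local instance] Matrix.linftyOpNormedRing Matrix.linftyOpNormedAlgebra

/-- The Collatz–Wielandt bound: `μ w ≤ B w` for a positive vector `w` forces `μ ≤ λ(B)`. -/
theorem le_spectralRadius_of_mul_le_mulVec [Nonempty ι] {B : Matrix ι ι ℝ} (hB : ∀ i j, 0 ≤ B i j)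
    {w : ι → ℝ} (hw : ∀ i, 0 < w i) {μ : ℝ} (hμ : 0 ≤ μ) (h : ∀ i, μ * w i ≤ (B *ᵥ w) i) :
    ENNReal.ofReal μ ≤ spectralRadius ℂ (B.map (algebraMap ℝ ℂ)) := by
  have hwc : 0 < ‖fun i => (w i : ℂ)‖ := by
    rw [norm_pos_iff]
    intro h0
    have := congrFun h0 (Classical.arbitrary ι)
    simp only [Pi.zero_apply, Complex.ofReal_eq_zero] at this
    exact (hw _).ne' this
  -- Testing `B ^ n` on `w` bounds its operator norm from below.
  have hpow : ∀ n : ℕ, μ ^ n ≤ ‖(B.map (algebraMap ℝ ℂ)) ^ n‖ := by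
    intro n
    have h1 : ((B.map (algebraMap ℝ ℂ)) ^ n) *ᵥ (fun i => (w i : ℂ)) =
        fun i => (((B ^ n) *ᵥ w) i : ℂ) := by
      have : (B.map (algebraMap ℝ ℂ)) ^ n = (B ^ n).map (algebraMap ℝ ℂ) :=
        ((algebraMap ℝ ℂ).mapMatrix.map_pow B n).symm
      rw [this]
      funext i
      simp [mulVec, dotProduct]
    have h2 := linfty_opNorm_mulVec ((B.map (algebraMap ℝ ℂ)) ^ n) (fun i => (w i : ℂ))
    rw [h1] at h2
    have h3 : μ ^ n * ‖fun i => (w i : ℂ)‖ ≤ ‖fun i => (((B ^ n) *ᵥ w) i : ℂ)‖ := by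
      rw [← abs_of_nonneg (pow_nonneg hμ n), ← Real.norm_eq_abs, ← norm_smul]
      refine (pi_norm_le_iff_of_nonneg (norm_nonneg _)).2 fun i => ?_
      refine le_trans ?_ (norm_le_pi_norm _ i)
      have h4 := pow_mulVec_ge hB hμ h n i
      rw [Pi.smul_apply, norm_smul, Complex.norm_real, Complex.norm_real, Real.norm_eq_abs,
        Real.norm_eq_abs, Real.norm_eq_abs, abs_of_nonneg (pow_nonneg hμ n),
        abs_of_pos (hw i)]
      exact h4.trans (le_abs_self _)
    exact le_of_mul_le_mul_right (h3.trans h2) hwc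
  -- Gelfand's formula: take `n`-th roots of the norm bound and pass to the limit.
  refine ge_of_tendsto (spectrum.pow_nnnorm_pow_one_div_tendsto_nhds_spectralRadius
    (B.map (algebraMap ℝ ℂ))) ?_
  filter_upwards [Filter.eventually_gt_atTop 0] with n hn
  have h1 : ENNReal.ofReal (μ ^ n) ≤ (‖(B.map (algebraMap ℝ ℂ)) ^ n‖₊ : ENNReal) := by
    rw [← ENNReal.ofReal_coe_nnreal]
    exact ENNReal.ofReal_le_ofReal (hpow n)
  have h2 := ENNReal.rpow_le_rpow h1 (by positivity : (0 : ℝ) ≤ 1 / n)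
  rwa [ENNReal.ofReal_pow hμ, ← ENNReal.rpow_natCast, ← ENNReal.rpow_mul,
    mul_one_div_cancel (by positivity), ENNReal.rpow_one] at h2

/-- A complex square matrix has an eigenvalue whose modulus is the spectral radius. -/
theorem exists_eigenvector_of_spectralRadius [Nonempty ι] (M : Matrix ι ι ℂ) :
    ∃ (z : ℂ) (v : ι → ℂ), (‖z‖₊ : ENNReal) = spectralRadius ℂ M ∧ v ≠ 0 ∧ M *ᵥ v = z • v := by
  obtain ⟨z, hz, hr⟩ := spectrum.exists_nnnorm_eq_spectralRadius M
  rw [← spectrum_toLin', ← Module.End.hasEigenvalue_iff_mem_spectrum] at hz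
  obtain ⟨v, hv⟩ := hz.exists_hasEigenvector
  exact ⟨z, v, hr, hv.2, by simpa using hv.apply_eq_smul⟩

end Norm

/-- The Perron vector of an irreducible nonnegative matrix with spectral radius `1`. -/
theorem exists_pos_mulVec_eq_self [Nonempty ι] {B : Matrix ι ι ℝ} (hB : ∀ i j, 0 ≤ B i j)
    (hirr : ∀ a b, Relation.ReflTransGen (fun a b => 0 < B b a) a b)
    (hsr : spectralRadius ℂ (B.map (algebraMap ℝ ℂ)) = 1) :
    ∃ u : ι → ℝ, (∀ i, 0 < u i) ∧ B *ᵥ u = u := by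
  obtain ⟨z, v, hz, hv0, hv⟩ := exists_eigenvector_of_spectralRadius (B.map (algebraMap ℝ ℂ))
  have hz1 : ‖z‖ = 1 := by
    rw [hsr] at hz
    have : ‖z‖₊ = 1 := by exact_mod_cast hz
    simpa using congrArg NNReal.toReal this
  set u : ι → ℝ := fun i => ‖v i‖ with hu
  have hu0 : ∀ i, 0 ≤ u i := fun i => norm_nonneg _
  obtain ⟨a, ha⟩ : ∃ a, 0 < u a := by
    obtain ⟨a, ha⟩ := Function.ne_iff.1 hv0
    exact ⟨a, norm_pos_iff.2 ha⟩
  -- Triangle inequality in the eigenvector equation, whose eigenvalue has modulus 1.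
  have hle : ∀ i, u i ≤ (B *ᵥ u) i := by
    intro i
    have h1 := congrArg norm (congrFun hv i)
    rw [Pi.smul_apply, norm_smul, hz1, one_mul] at h1
    rw [hu]
    change ‖v i‖ ≤ _
    rw [← h1]
    refine (norm_sum_le _ _).trans (Finset.sum_le_sum fun j _ => ?_)
    rw [norm_mul]
    simp [abs_of_nonneg (hB i j)]
  -- If the excess `B u - u` were nonzero, powers of `1 + B`, which commute with `B`, would spread
  -- both it and `u` over all coordinates. The result is a positive `w` with `B w > w` everywhere,
  -- hence `B w ≥ (1 + ε) w`, and the Collatz–Wielandt bound contradicts spectral radius 1.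
  have hfix : B *ᵥ u = u := by
    by_contra hne
    obtain ⟨b, hb⟩ := Function.ne_iff.1 hne
    have hyb : 0 < (B *ᵥ u - u) b := sub_pos.2 (lt_of_le_of_ne (hle b) (Ne.symm hb))
    obtain ⟨n, hn⟩ := exists_one_add_pow_mulVec_pos hB hirr
      (v := B *ᵥ u - u) (fun i => sub_nonneg.2 (hle i)) hyb
    obtain ⟨m, hm⟩ := exists_one_add_pow_mulVec_pos hB hirr hu0 ha
    set w := ((1 + B) ^ m) *ᵥ (((1 + B) ^ n) *ᵥ u) with hw
    have hcomm : ∀ k : ℕ, Commute B ((1 + B) ^ k) := fun k =>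
      ((Commute.one_right B).add_right (Commute.refl B)).pow_right k
    have hpos : ∀ (k : ℕ) (x : ι → ℝ), (∀ i, 0 < x i) → ∀ i, 0 < (((1 + B) ^ k) *ᵥ x) i := by
      intro k
      induction k with
      | zero => intro x hx; simpa using hx
      | succ k ih =>
        intro x hx
        rw [pow_succ, ← mulVec_mulVec]
        refine ih _ fun i => ?_
        rw [add_mulVec, one_mulVec]
        exact add_pos_of_pos_of_nonneg (hx i)
          (Finset.sum_nonneg fun j _ => mul_nonneg (hB _ _) (hx j).le)
    have hw' : w = ((1 + B) ^ n) *ᵥ (((1 + B) ^ m) *ᵥ u) := by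
      rw [hw, mulVec_mulVec, mulVec_mulVec, ← pow_add, ← pow_add, add_comm n m]
    have hwpos : ∀ i, 0 < w i := by
      rw [hw']; exact hpos n _ hm
    have hdiff : B *ᵥ w - w = ((1 + B) ^ m) *ᵥ (((1 + B) ^ n) *ᵥ (B *ᵥ u - u)) := by
      rw [hw, mulVec_sub, mulVec_sub]
      congr 1
      simp only [mulVec_mulVec]
      rw [← mul_assoc, (hcomm m).eq, mul_assoc, (hcomm n).eq, ← mul_assoc]
    have hgt : ∀ i, 0 < (B *ᵥ w - w) i := by
      rw [hdiff]; exact hpos m _ hn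
    obtain ⟨j, hj⟩ := Finite.exists_min fun i => (B *ᵥ w - w) i / w i
    set ε := (B *ᵥ w - w) j / w j
    have hε : 0 < ε := div_pos (hgt j) (hwpos j)
    have hcw : ∀ i, (1 + ε) * w i ≤ (B *ᵥ w) i := by
      intro i
      have := (le_div_iff₀ (hwpos i)).1 (hj i)
      simp only [Pi.sub_apply] at this
      linarith
    have := le_spectralRadius_of_mul_le_mulVec hB hwpos (by positivity) hcw
    rw [hsr, ENNReal.ofReal_le_one] at this
    linarith
  exact ⟨u, pos_of_mulVec_eq_self hB hirr hu0 hfix ha, hfix⟩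

-- Subtract from `w` the largest multiple of `u` that leaves a nonnegative vector. The remainder is
-- fixed by `B` and vanishes at the minimizing coordinate; were it nonzero, irreducibility would
-- make it positive there.
omit [DecidableEq ι] in
theorem exists_smul_of_mulVec_eq_self [Nonempty ι] {B : Matrix ι ι ℝ} (hB : ∀ i j, 0 ≤ B i j)
    (hirr : ∀ a b, Relation.ReflTransGen (fun a b => 0 < B b a) a b)
    {u : ι → ℝ} (hu : ∀ i, 0 < u i) (hfix : B *ᵥ u = u) {w : ι → ℝ} (hw : B *ᵥ w = w) :
    ∃ c : ℝ, w = c • u := by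
  obtain ⟨j, hj⟩ := Finite.exists_min fun i => w i / u i
  refine ⟨w j / u j, ?_⟩
  by_contra hne
  have hnn : ∀ i, 0 ≤ (w - (w j / u j) • u) i := fun i => by
    have := (le_div_iff₀ (hu i)).1 (hj i)
    simpa using this
  have hf : B *ᵥ (w - (w j / u j) • u) = w - (w j / u j) • u := by
    rw [mulVec_sub, mulVec_smul, hw, hfix]
  obtain ⟨a, ha⟩ := Function.ne_iff.1 hne
  have hpa : 0 < (w - (w j / u j) • u) a := lt_of_le_of_ne (hnn a) fun h => ha (by
    simp only [Pi.sub_apply] at h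
    linarith)
  have := pos_of_mulVec_eq_self hB hirr hnn hf hpa j
  simp [div_mul_cancel₀ _ (hu j).ne'] at this

/-- The integral Perron vector of an irreducible nonnegative rational matrix with spectral radius
`1`. -/
theorem exists_int_pos_spanning_eigenspace [Nonempty ι] {B : Matrix ι ι ℚ} (hB : ∀ i j, 0 ≤ B i j)
    (hirr : ∀ a b, Relation.ReflTransGen (fun a b => 0 < B b a) a b)
    (hsr : spectralRadius ℂ (B.map (algebraMap ℚ ℂ)) = 1) :
    ∃ r : ι → ℤ, (∀ a, 0 < r a) ∧ Finset.univ.gcd r = 1 ∧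
      Module.End.eigenspace (Matrix.toLin' (B.map (algebraMap ℚ ℝ))) 1 =
        Submodule.span ℝ {fun a => (r a : ℝ)} := by
  set BR := B.map (algebraMap ℚ ℝ) with hBR
  have hBR0 : ∀ i j, 0 ≤ BR i j := fun i j => by
    simp only [hBR, map_apply, eq_ratCast]; exact_mod_cast hB i j
  have hirrR : ∀ a b, Relation.ReflTransGen (fun a b => 0 < BR b a) a b := fun a b =>
    (hirr a b).lift id fun i j h => by
      simp only [hBR, map_apply, eq_ratCast]; exact_mod_cast h
  have hsrR : spectralRadius ℂ (BR.map (algebraMap ℝ ℂ)) = 1 := by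
    rw [← hsr]; congr 1
  obtain ⟨u, hu, hfix⟩ := exists_pos_mulVec_eq_self hBR0 hirrR hsrR
  have hdetR : (BR - 1).det = 0 := exists_mulVec_eq_zero_iff.1
    ⟨u, fun h => (hu (Classical.arbitrary ι)).ne' (congrFun h _), by
      rw [sub_mulVec, one_mulVec, hfix, sub_self]⟩
  -- Singularity descends from `ℝ` to `ℚ` through the determinant, which produces a rational
  -- eigenvector.
  have hdet : (B - 1).det = 0 := by
    have h1 : (algebraMap ℚ ℝ) (B - 1).det = (BR - 1).det := by
      rw [RingHom.map_det, map_sub, map_one]; rfl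
    rw [hdetR] at h1
    exact (map_eq_zero _).1 h1
  obtain ⟨v, hv0, hv⟩ := exists_mulVec_eq_zero_iff.2 hdet
  obtain ⟨⟨b, hb⟩, hint⟩ := IsLocalization.exist_integer_multiples_of_finite
    (nonZeroDivisors ℤ) v
  choose k hk using hint
  have hb0 : (b : ℚ) ≠ 0 := by exact_mod_cast nonZeroDivisors.ne_zero hb
  have hk' : ∀ i, (k i : ℚ) = b * v i := fun i => by simpa [zsmul_eq_mul] using hk i
  have hkfix : BR *ᵥ (fun i => (k i : ℝ)) = fun i => (k i : ℝ) := by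
    funext i
    have h1 := congrFun hv i
    rw [sub_mulVec, one_mulVec, Pi.sub_apply, Pi.zero_apply, sub_eq_zero] at h1
    have h2 : ∑ j, B i j * (k j : ℚ) = k i := by
      rw [hk' i, ← h1]
      simp only [mulVec, dotProduct, Finset.mul_sum]
      exact Finset.sum_congr rfl fun j _ => by rw [hk' j]; ring
    have h3 := congrArg (Rat.cast (K := ℝ)) h2
    push_cast at h3
    simpa [mulVec, dotProduct, hBR] using h3
  obtain ⟨c, hc⟩ := exists_smul_of_mulVec_eq_self hBR0 hirrR hu hfix hkfix
  obtain ⟨a₀, ha₀⟩ := Function.ne_iff.1 hv0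
  have hka₀ : k a₀ ≠ 0 := fun h => by
    have := hk' a₀
    rw [h, Int.cast_zero, eq_comm, mul_eq_zero] at this
    exact this.elim hb0 ha₀
  have hc0 : c ≠ 0 := by
    rintro rfl
    have := congrFun hc a₀
    simp only [zero_smul, Pi.zero_apply, Int.cast_eq_zero] at this
    exact hka₀ this
  -- `k` is a multiple of the positive vector `u`, but perhaps a negative one; absolute values
  -- repair the sign.
  obtain ⟨g, hg, hgcd⟩ := Finset.extract_gcd (fun i => |k i|)
    (Finset.univ_nonempty (α := ι))
  set d := Finset.univ.gcd fun i => |k i| with hd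
  have hg' : ∀ i, |k i| = d * g i := fun i => hg i (Finset.mem_univ i)
  have hkpos : ∀ i, 0 < |k i| := fun i => abs_pos.2 fun h => by
    have := congrFun hc i
    rw [h] at this
    simp only [Int.cast_zero, Pi.smul_apply, smul_eq_mul, zero_eq_mul] at this
    exact this.elim hc0 (hu i).ne'
  have hd0 : 0 < d := by
    refine lt_of_le_of_ne (Int.nonneg_of_normalize_eq_self Finset.normalize_gcd) fun h => ?_
    have := hkpos a₀
    rw [hg', ← h, zero_mul] at this
    exact this.false
  have hgpos : ∀ i, 0 < g i := fun i => by
    have := hkpos i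
    rw [hg'] at this
    exact pos_of_mul_pos_right this hd0.le
  have hgu : ∀ i, (g i : ℝ) = |c| / d * u i := fun i => by
    have h1 := congrArg (Int.cast (R := ℝ)) (hg' i)
    have h2 := congrFun hc i
    push_cast at h1
    rw [h2, Pi.smul_apply, smul_eq_mul, abs_mul, abs_of_pos (hu i)] at h1
    have : (d : ℝ) ≠ 0 := by exact_mod_cast hd0.ne'
    field_simp
    linarith
  have hcd : |c| / d ≠ 0 := div_ne_zero (abs_ne_zero.2 hc0) (by exact_mod_cast hd0.ne')
  have hgu' : (fun i => (g i : ℝ)) = (|c| / d) • u := funext hgu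
  refine ⟨g, hgpos, hgcd, ?_⟩
  ext w
  rw [Module.End.mem_eigenspace_iff, one_smul, toLin'_apply, hgu',
    Submodule.span_singleton_smul_eq (IsUnit.mk0 _ hcd), Submodule.mem_span_singleton]
  constructor
  · intro hw
    obtain ⟨c', hc'⟩ := exists_smul_of_mulVec_eq_self hBR0 hirrR hu hfix hw
    exact ⟨c', hc'.symm⟩
  · rintro ⟨c', rfl⟩
    rw [mulVec_smul, hfix]

theorem spectralRadius_transpose (M : Matrix ι ι ℂ) :
    spectralRadius ℂ Mᵀ = spectralRadius ℂ M := by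
  have : spectrum ℂ Mᵀ = spectrum ℂ M := by
    ext z
    rw [mem_spectrum_iff_isRoot_charpoly, mem_spectrum_iff_isRoot_charpoly, charpoly_transpose]
  rw [spectralRadius, spectralRadius, this]

end PerronFrobenius

end Matrix

namespace AbelianNetwork

noncomputable section

variable {V : Type*} [Fintype V] [DecidableEq V] {E : V → V → Type*} [∀ v u, Fintype (E v u)]
  {A : V → Type*} [∀ v, Fintype (A v)] [∀ v, DecidableEq (A v)]
  {S : V → Type*} [∀ v, Fintype (S v)]
  (N : AbelianNetwork V E A S)

set_option linter.unusedSectionVars false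

/-! ### Words, legal or not -/

/-- The configuration reached from `c` by processing the word `w`, legally or not. -/
def fireWord : List (Letter A) → Config A S → Config A S
  | [], c => c
  | a :: w, c => fireWord w (N.fire a c)

/-- Processing the word `w` from `c` is legal. -/
def Run : List (Letter A) → Config A S → Prop
  | [], _ => True
  | a :: w, c => 1 ≤ c.1 a ∧ Run w (N.fire a c)

theorem fireWord_append (w w' : List (Letter A)) (c : Config A S) :
    N.fireWord (w ++ w') c = N.fireWord w' (N.fireWord w c) := by
  induction w generalizing c with
  | nil => rfl
  | cons a w ih => exact ih _

theorem run_append (w w' : List (Letter A)) (c : Config A S) :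
    N.Run (w ++ w') c ↔ N.Run w c ∧ N.Run w' (N.fireWord w c) := by
  induction w generalizing c with
  | nil => simp [Run, fireWord]
  | cons a w ih => simp [Run, fireWord, ih, and_assoc]

theorem fireWord_perm {w w' : List (Letter A)} (h : w.Perm w') :
    ∀ c, N.fireWord w c = N.fireWord w' c := by
  induction h with
  | nil => intro q; rfl
  | cons a _ ih => intro q; exact ih _
  | swap a b l => intro q; simp [fireWord, N.fire_comm a b]
  | trans _ _ ih1 ih2 => intro q; rw [ih1, ih2]

theorem fireWord_snd (w : List (Letter A)) (c : Config A S) :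
    (N.fireWord w c).2 = N.tWord w c.2 := by
  induction w generalizing c with
  | nil => rfl
  | cons a w ih => exact ih _

theorem fireWord_fst (w : List (Letter A)) (c : Config A S) :
    (N.fireWord w c).1 = c.1 + natVec (N.emitWord w c.2) - natVec fun a => w.count a := by
  induction w generalizing c with
  | nil => funext b; simp [fireWord, emitWord, natVec]
  | cons a w ih =>
    funext b
    simp only [fireWord, ih, emitWord, natVec, fire, Pi.add_apply, Pi.sub_apply, List.count_cons]
    by_cases h : a = b
    · subst h; simp; ring
    · simp [h]; ring

theorem fireWord_add (w : List (Letter A)) (z : Letter A → ℤ) (c : Config A S) :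
    N.fireWord w (z + c.1, c.2) = (z + (N.fireWord w c).1, (N.fireWord w c).2) := by
  refine Prod.ext ?_ ?_
  · simp only [fireWord_fst]; abel
  · simp only [fireWord_snd]

theorem reaches_iff {c c' : Config A S} :
    N.Reaches c c' ↔ ∃ w, N.Run w c ∧ N.fireWord w c = c' := by
  constructor
  · intro h
    induction h with
    | refl => exact ⟨[], trivial, rfl⟩
    | @tail d e _ h ih =>
      obtain ⟨a, ha, rfl⟩ := h
      obtain ⟨w, hw, rfl⟩ := ih
      refine ⟨w ++ [a], ?_, ?_⟩
      · rw [run_append]; exact ⟨hw, ha, trivial⟩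
      · rw [fireWord_append]; rfl
  · rintro ⟨w, hw, rfl⟩
    induction w generalizing c with
    | nil => exact Relation.ReflTransGen.refl
    | cons a w ih => exact (ih hw.2).head ⟨a, hw.1, rfl⟩

theorem Run.reaches {w : List (Letter A)} {c : Config A S} (h : N.Run w c) :
    N.Reaches c (N.fireWord w c) :=
  N.reaches_iff.2 ⟨w, h, rfl⟩

theorem Reaches.legallyRelated {c c' : Config A S} (h : N.Reaches c c') : N.LegallyRelated c c' :=
  ⟨c', h, Relation.ReflTransGen.refl⟩

/-! ### The removal lemma and the least action principle -/

/-- The removal lemma for one letter. -/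
theorem Run.erase {w : List (Letter A)} {c : Config A S} (h : N.Run w c) (b : Letter A) :
    N.Run (w.erase b) (N.fire b c) := by
  induction w generalizing c with
  | nil => trivial
  | cons a w ih =>
    by_cases hab : a = b
    · subst hab
      rw [List.erase_cons_head]
      exact h.2
    · rw [List.erase_cons_tail (by simpa using hab)]
      refine ⟨(Step.fire N hab ⟨h.1, rfl⟩).1, ?_⟩
      rw [fire_comm]
      exact ih h.2

/-- The removal lemma: a legal word remains legal after a word `u` has been processed, legally or
not, if the letters of `u` are removed from it. -/
theorem Run.diff {w : List (Letter A)} {c : Config A S} (h : N.Run w c) (u : List (Letter A)) :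
    N.Run (w.diff u) (N.fireWord u c) := by
  induction u generalizing w c with
  | nil => simpa [fireWord] using h
  | cons b u ih =>
    rw [List.diff_cons]
    exact ih (h.erase N b)

theorem fireWord_diff {u w : List (Letter A)} (h : u.Subperm w) (c : Config A S) :
    N.fireWord (w.diff u) (N.fireWord u c) = N.fireWord w c := by
  rw [← fireWord_append]
  exact N.fireWord_perm (List.subperm_append_diff_self_of_count_le
    fun a _ => h.count_le a) c

/-- A legal word is contained in every word that leaves no letter to process. -/
theorem Run.length_le {w u : List (Letter A)} {c : Config A S} (h : N.Run w c)
    (hu : ∀ a, (N.fireWord u c).1 a ≤ 0) : w.length ≤ u.length := by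
  have h1 := h.diff N u
  have h2 : w.diff u = [] := by
    cases hd : w.diff u with
    | nil => rfl
    | cons a v =>
      rw [hd] at h1
      have := hu a
      have := h1.1
      omega
  have h3 : w.Subperm u := by
    rw [List.subperm_iff_count]
    intro a
    have := congrArg (List.count a) h2
    rw [List.count_diff, List.count_nil] at this
    omega
  exact h3.length_le

theorem Halts.of_reaches {c c' : Config A S} (h : N.Reaches c c') (h' : N.Halts c') :
    N.Halts c := by
  obtain ⟨d, hd, hd'⟩ := h'
  exact ⟨d, h.trans hd, hd'⟩

theorem exists_step_of_not_halts {c : Config A S} (h : ¬ N.Halts c) :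
    ∃ a, N.Step a c (N.fire a c) ∧ ¬ N.Halts (N.fire a c) := by
  obtain ⟨a, ha⟩ : ∃ a, 1 ≤ c.1 a := by
    by_contra! hne
    exact h ⟨c, Relation.ReflTransGen.refl, fun a => by have := hne a; omega⟩
  exact ⟨a, ⟨ha, rfl⟩, fun h' =>
    h (Halts.of_reaches N (Relation.ReflTransGen.single ⟨a, ha, rfl⟩) h')⟩

theorem exists_run_of_not_halts {c : Config A S} (h : ¬ N.Halts c) (n : ℕ) :
    ∃ w, N.Run w c ∧ w.length = n := by
  induction n generalizing c with
  | zero => exact ⟨[], trivial, rfl⟩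
  | succ n ih =>
    obtain ⟨a, ha, h'⟩ := N.exists_step_of_not_halts h
    obtain ⟨w, hw, hl⟩ := ih h'
    exact ⟨a :: w, ⟨ha.1, hw⟩, by simp [hl]⟩

/-- The least action principle: processing letters illegally does not help to halt. -/
theorem Halts.of_fireWord {u : List (Letter A)} {c : Config A S} (h : N.Halts (N.fireWord u c)) :
    N.Halts c := by
  by_contra hc
  obtain ⟨d, hd, hd'⟩ := h
  obtain ⟨v, -, rfl⟩ := N.reaches_iff.1 hd
  -- Without halting there are legal words of every length, but `u ++ v` exhausts all letters and so
  -- bounds the length of every legal word.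
  obtain ⟨w, hw, hl⟩ := N.exists_run_of_not_halts hc ((u ++ v).length + 1)
  have := hw.length_le N (u := u ++ v) (by rwa [fireWord_append])
  omega

theorem run_add {w : List (Letter A)} {c : Config A S} (h : N.Run w c) {z : Letter A → ℤ}
    (hz : ∀ a, 0 ≤ z a) : N.Run w (z + c.1, c.2) := by
  induction w generalizing c with
  | nil => trivial
  | cons a w ih =>
    refine ⟨?_, ?_⟩
    · have := h.1
      have := hz a
      simp only [Pi.add_apply]
      omega
    · have h1 := N.fireWord_add [a] z c
      simp only [fireWord] at h1
      rw [h1]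
      exact ih h.2

/-- Adding letters to a configuration that does not halt. -/
theorem not_halts_add {c : Config A S} (h : ¬ N.Halts c) {z : Letter A → ℤ}
    (hz : ∀ a, 0 ≤ z a) : ¬ N.Halts (z + c.1, c.2) := by
  rintro ⟨d, hd, hd'⟩
  obtain ⟨u, -, rfl⟩ := N.reaches_iff.1 hd
  obtain ⟨w, hw, hl⟩ := N.exists_run_of_not_halts h (u.length + 1)
  have := (N.run_add hw hz).length_le N hd'
  omega

/-- The count of a letter drops only when that letter is processed, by at most one and from a value
at least 1. -/
theorem run_lower {w : List (Letter A)} {c : Config A S} (h : N.Run w c) (a : Letter A) :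
    min (c.1 a) 0 ≤ (N.fireWord w c).1 a := by
  induction w generalizing c with
  | nil => exact min_le_left _ _
  | cons b w ih =>
    refine le_trans ?_ (ih h.2)
    have h1 := h.1
    simp only [fire]
    by_cases hab : a = b
    · subst hab; simp; omega
    · rw [Pi.single_eq_of_ne hab]; omega

theorem comp_eq_iff {c c' : Config A S} : N.comp c = N.comp c' ↔ N.LegallyRelated c c' :=
  Quotient.eq (r := ⟨N.LegallyRelated, N.legallyRelated_equivalence⟩)

theorem run_flatten_replicate {v : List (Letter A)} {c : Config A S} (h : N.Run v c)
    (hc : N.fireWord v c = c) (m : ℕ) : N.Run (List.replicate m v).flatten c ∧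
      N.fireWord (List.replicate m v).flatten c = c := by
  induction m with
  | zero => exact ⟨trivial, rfl⟩
  | succ m ih =>
    rw [List.replicate_succ, List.flatten_cons, run_append, fireWord_append, hc]
    exact ⟨⟨h, ih.1⟩, ih.2⟩

theorem subperm_flatten_replicate {v : List (Letter A)} (hv : ∀ a, a ∈ v) (u : List (Letter A)) :
    u.Subperm (List.replicate u.length v).flatten := by
  rw [List.subperm_iff_count]
  intro a
  have h1 : 0 < v.count a := List.count_pos_iff.2 (hv a)
  have h2 : u.count a ≤ u.length := List.count_le_length
  have h3 : (List.replicate u.length v).flatten.count a = u.length * v.count a := by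
    simp [List.count_flatten]
  rw [h3]
  nlinarith

/-- A configuration on a closed legal walk through all letters can be recovered after any word. -/
theorem reaches_of_cycle {v : List (Letter A)} {c : Config A S} (hv : ∀ a, a ∈ v)
    (h : N.Run v c) (hc : N.fireWord v c = c) (u : List (Letter A)) :
    N.Reaches (N.fireWord u c) c := by
  -- Going round the cycle `u.length` times uses each letter at least as often as `u` does. After
  -- removal of `u`, what is left is a legal way back to `c`.
  obtain ⟨h1, h2⟩ := N.run_flatten_replicate h hc u.length
  refine N.reaches_iff.2 ⟨_, h1.diff N u, ?_⟩
  rw [N.fireWord_diff (subperm_flatten_replicate hv u), h2]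

theorem isRecurrentConfig_of_cycle {v : List (Letter A)} {c : Config A S} (hv : ∀ a, a ∈ v)
    (hne : v ≠ []) (h : N.Run v c) (hc : N.fireWord v c = c) : N.IsRecurrentConfig c := by
  refine ⟨?_, ?_⟩
  · cases v with
    | nil => exact (hne rfl).elim
    | cons a v => exact ⟨a, _, h.1, rfl⟩
  · rintro c' ⟨d, h1, h2⟩
    obtain ⟨u, hu, rfl⟩ := N.reaches_iff.1 h1
    exact h2.trans (N.reaches_of_cycle hv h hc u)

theorem IsRecurrentConfig.exists_cycle {c : Config A S} (h : N.IsRecurrentConfig c) :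
    ∃ v, v ≠ [] ∧ N.Run v c ∧ N.fireWord v c = c := by
  obtain ⟨⟨a, c', h⟩, hr⟩ := h
  have h1 : N.Reaches c c' := Relation.ReflTransGen.single ⟨a, h⟩
  obtain ⟨w, hw, hwc⟩ := N.reaches_iff.1 (hr c' (Reaches.legallyRelated N h1))
  rw [h.2] at hw hwc
  exact ⟨a :: w, by simp, ⟨h.1, hw⟩, hwc⟩

end

end AbelianNetwork

namespace AbelianNetwork

noncomputable section

variable {V : Type*} [Fintype V] [DecidableEq V] {E : V → V → Type*} [∀ v u, Fintype (E v u)]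
  {A : V → Type*} [∀ v, Fintype (A v)] [∀ v, DecidableEq (A v)]
  {S : V → Type*} [∀ v, Fintype (S v)]
  (N : AbelianNetwork V E A S)

set_option linter.unusedSectionVars false

/-! ### Periods -/

/-- The product of the periods of the single letters is a common period. -/
theorem exists_period : ∃ D : ℕ, 0 < D ∧ ∀ n : Letter A → ℕ, D • n ∈ N.fixing := by
  choose d hd hmem using N.exists_single_mem_fixing
  refine ⟨∏ a, d a, Finset.prod_pos fun a _ => hd a, fun n => ?_⟩
  have h : (∏ a, d a) • n = ∑ a, ((∏ a, d a) / d a * n a) • (Pi.single a (d a) : Letter A → ℕ) := by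
    funext b
    rw [Finset.sum_apply, Finset.sum_eq_single b]
    · simp only [Pi.smul_apply, smul_eq_mul, Pi.single_eq_same]
      rw [mul_right_comm, Nat.div_mul_cancel (Finset.dvd_prod_of_mem _ (Finset.mem_univ b))]
    · intro a _ hab
      simp [Pi.single_eq_of_ne hab.symm]
    · simp
  rw [h]
  exact sum_mem fun a _ => nsmul_mem (hmem a) _

theorem exists_word_of_mem_transMonoid {f : Function.End (State S)} (hf : f ∈ N.transMonoid) :
    ∃ w, ∀ q, N.tWord w q = f q := by
  refine Submonoid.closure_induction (motive := fun f _ => ∃ w, ∀ q, N.tWord w q = f q)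
    ?_ ?_ ?_ hf
  · rintro _ ⟨a, rfl⟩
    exact ⟨[a], fun q => rfl⟩
  · exact ⟨[], fun q => rfl⟩
  · rintro f g _ _ ⟨w, hw⟩ ⟨w', hw'⟩
    exact ⟨w' ++ w, fun q => by rw [tWord_append, hw', hw]; rfl⟩

theorem exists_tVec_mem_Loc : ∃ n : Letter A → ℕ, ∀ q, N.tVec n q ∈ N.Loc := by
  obtain ⟨w, hw⟩ := N.exists_word_of_mem_transMonoid N.minIdem.2
  exact ⟨_, fun q => by rw [← tWord_eq_tVec, hw]; exact ⟨q, rfl⟩⟩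

/-- One fixed state suffices, even one outside `Loc`: local irreducibility joins it to any `p` in
`Loc`, processing `n` commutes with the joining words, and injectivity on `Loc` cancels them. -/
theorem mem_fixing_of_tVec_eq (hN : N.LocallyIrreducible) {n : Letter A → ℕ} {q : State S}
    (h : N.tVec n q = q) : n ∈ N.fixing := by
  intro p hp
  obtain ⟨w, w', hw⟩ := hN p q
  rw [tWord_eq_tVec, tWord_eq_tVec] at hw
  refine N.tVec_injOn_Loc (fun a => w.count a) (N.tVec_mem_Loc _ hp) hp ?_
  rw [← tVec_add, add_comm, tVec_add, hw, ← tVec_add, add_comm, tVec_add, h]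

/-- A state fixed by a positive vector is locally recurrent. -/
theorem mem_Loc_of_tVec_eq {n : Letter A → ℕ} (hn : ∀ a, 0 < n a) {q : State S}
    (h : N.tVec n q = q) : q ∈ N.Loc := by
  obtain ⟨e, he⟩ := N.exists_tVec_mem_Loc
  have hj : ∀ j : ℕ, N.tVec (j • n) q = q := by
    intro j
    induction j with
    | zero => rw [zero_smul, tVec_zero]
    | succ j ih => rw [succ_nsmul, tVec_add, ih, h]
  -- A large multiple of `n` still fixes `q` and dominates `e`, which carries every state into
  -- `Loc`.
  have hle : e ≤ (∑ a, e a) • n := fun a => by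
    have := Finset.single_le_sum (fun a _ => Nat.zero_le (e a)) (Finset.mem_univ a)
    have := hn a
    simp only [Pi.smul_apply, smul_eq_mul]
    nlinarith
  rw [← hj (∑ a, e a), ← add_tsub_cancel_of_le hle, tVec_add]
  exact N.tVec_mem_Loc _ (he q)

variable [∀ v, Nonempty (S v)]

/-- `P k = N_k(q)`. -/
theorem productionMatrix_mulVec (hN : N.LocallyIrreducible) {k : Letter A → ℕ}
    (hk : k ∈ N.fixing) {q : State S} (hq : q ∈ N.Loc) (b : Letter A) :
    ∑ a, N.productionMatrix b a * (k a : ℚ) = N.emitVec k q b :=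
  congrFun (N.isProductionMatrix_productionMatrix hN q hq k ((N.natVec_mem_totalKernel k).2 hk)) b

theorem productionMatrix_nonneg (hN : N.LocallyIrreducible) (b a : Letter A) :
    0 ≤ N.productionMatrix b a := by
  obtain ⟨d, hd, hmem⟩ := N.exists_single_mem_fixing a
  obtain ⟨q, hq⟩ := N.Loc_nonempty
  have h := N.productionMatrix_mulVec hN hmem hq b
  rw [Finset.sum_eq_single a (fun c _ hc => by simp [Pi.single_eq_of_ne hc]) (by simp),
    Pi.single_eq_same] at h
  have h1 : (0 : ℚ) ≤ N.productionMatrix b a * d := by rw [h]; positivity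
  exact nonneg_of_mul_nonneg_left h1 (by exact_mod_cast hd)

/-- A locally irreducible, strongly connected, critical network. -/
structure IsIrreducibleCritical : Prop where
  locallyIrreducible : N.LocallyIrreducible
  stronglyConnected : N.StronglyConnected
  critical : N.Critical

variable {N}

/-! ### The exchange rate vector and the weight -/

namespace IsIrreducibleCritical

/-- The integral Perron vector of the transpose is a witness: its digraph is the reversed production
digraph, and its spectral radius is again 1. -/
theorem isExchangeRate (hN : N.IsIrreducibleCritical) : N.IsExchangeRate N.exchangeRate := by
  have : Nonempty (Letter A) := hN.stronglyConnected.1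
  have hsr : spectralRadius ℂ (N.productionMatrix.transpose.map (algebraMap ℚ ℂ)) = 1 := by
    rw [Matrix.transpose_map, Matrix.spectralRadius_transpose]
    exact hN.critical
  obtain ⟨r, h1, h2, h3⟩ := Matrix.exists_int_pos_spanning_eigenspace
    (B := N.productionMatrix.transpose)
    (fun i j => N.productionMatrix_nonneg hN.locallyIrreducible j i)
    (fun a b => Relation.reflTransGen_swap.1 (hN.stronglyConnected.2 b a)) hsr
  refine Classical.epsilon_spec (p := N.IsExchangeRate) ⟨r, h1, h2, ?_⟩
  rw [hsr]
  simpa using h3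

theorem eigenspace_transpose (hN : N.IsIrreducibleCritical) :
    Module.End.eigenspace (Matrix.toLin' (N.productionMatrix.transpose.map (algebraMap ℚ ℝ))) 1 =
      Submodule.span ℝ {fun a => (N.exchangeRate a : ℝ)} := by
  have hsr : spectralRadius ℂ (N.productionMatrix.transpose.map (algebraMap ℚ ℂ)) = 1 := by
    rw [Matrix.transpose_map, Matrix.spectralRadius_transpose]
    exact hN.critical
  have h := hN.isExchangeRate.2.2
  rwa [hsr, ENNReal.toReal_one] at h

theorem exchangeRate_pos (hN : N.IsIrreducibleCritical) (a : Letter A) : 0 < N.exchangeRate a :=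
  hN.isExchangeRate.1 a

theorem exchangeRate_mul (hN : N.IsIrreducibleCritical) (a : Letter A) :
    ∑ b, (N.exchangeRate b : ℚ) * N.productionMatrix b a = N.exchangeRate a := by
  have h : (fun a => (N.exchangeRate a : ℝ)) ∈ Module.End.eigenspace
      (Matrix.toLin' (N.productionMatrix.transpose.map (algebraMap ℚ ℝ))) 1 := by
    rw [hN.eigenspace_transpose]
    exact Submodule.mem_span_singleton_self _
  rw [Module.End.mem_eigenspace_iff, one_smul, Matrix.toLin'_apply] at h
  have h1 := congrFun h a
  simp only [Matrix.mulVec, dotProduct, Matrix.map_apply, Matrix.transpose_apply,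
    eq_ratCast] at h1
  have h2 : ((∑ b, (N.exchangeRate b : ℚ) * N.productionMatrix b a : ℚ) : ℝ) =
      ((N.exchangeRate a : ℚ) : ℝ) := by
    push_cast
    rw [← h1]
    exact Finset.sum_congr rfl fun b _ => mul_comm _ _
  exact_mod_cast h2

/-- `sᵀ P = sᵀ`. -/
theorem exchangeRate_mulVec (hN : N.IsIrreducibleCritical) (v : Letter A → ℚ) :
    ∑ b, (N.exchangeRate b : ℚ) * N.productionMatrix.mulVec v b =
      ∑ a, (N.exchangeRate a : ℚ) * v a := by
  simp only [Matrix.mulVec, dotProduct, Finset.mul_sum]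
  rw [Finset.sum_comm]
  refine Finset.sum_congr rfl fun a _ => ?_
  rw [← hN.exchangeRate_mul a, Finset.sum_mul]
  exact Finset.sum_congr rfl fun b _ => by ring

end IsIrreducibleCritical

variable (N)

theorem weight_add (x y : Letter A → ℤ) : N.weight (x + y) = N.weight x + N.weight y := by
  simp [weight, mul_add, Finset.sum_add_distrib]

theorem weight_neg (x : Letter A → ℤ) : N.weight (-x) = -N.weight x := by
  simp [weight]

theorem weight_sub (x y : Letter A → ℤ) : N.weight (x - y) = N.weight x - N.weight y := by
  rw [sub_eq_add_neg, weight_add, weight_neg, sub_eq_add_neg]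

theorem natVec_add (m n : Letter A → ℕ) : natVec (m + n) = natVec m + natVec n := by
  funext a; simp [natVec]

variable {N}

namespace IsIrreducibleCritical

/-- This is `sᵀ P = sᵀ` applied to `P k = N_k(q)`. -/
theorem weight_emitVec (hN : N.IsIrreducibleCritical) {k : Letter A → ℕ}
    (hk : k ∈ N.fixing) {q : State S} (hq : q ∈ N.Loc) :
    N.weight (natVec (N.emitVec k q)) = N.weight (natVec k) := by
  have h := hN.exchangeRate_mulVec fun a => (k a : ℚ)
  simp only [Matrix.mulVec, dotProduct,
    N.productionMatrix_mulVec hN.locallyIrreducible hk hq] at h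
  simp only [weight, natVec]
  exact_mod_cast h

/-- The period vector: a positive vector that returns every locally recurrent configuration to
itself. -/
theorem exists_period_vector (hN : N.IsIrreducibleCritical) :
    ∃ r ∈ N.fixing, (∀ a, 0 < r a) ∧ ∀ q ∈ N.Loc, N.emitVec r q = r := by
  have : Nonempty (Letter A) := hN.stronglyConnected.1
  obtain ⟨r, h1, -, h3⟩ := Matrix.exists_int_pos_spanning_eigenspace (B := N.productionMatrix)
    (N.productionMatrix_nonneg hN.locallyIrreducible) hN.stronglyConnected.2 hN.critical
  obtain ⟨D, hD, hmem⟩ := N.exists_period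
  -- Scaling the integral Perron vector of `P` by the common period puts it into `K` and preserves
  -- `P r = r`.
  refine ⟨D • fun a => (r a).toNat, hmem _, fun a => ?_, fun q hq => ?_⟩
  · have := h1 a
    have : 0 < (r a).toNat := by omega
    simp only [Pi.smul_apply, smul_eq_mul]
    positivity
  · funext b
    have h := N.productionMatrix_mulVec hN.locallyIrreducible (hmem fun a => (r a).toNat) hq b
    have hr : (fun a => (r a : ℝ)) ∈ Module.End.eigenspace
        (Matrix.toLin' (N.productionMatrix.map (algebraMap ℚ ℝ))) 1 := by
      rw [h3]; exact Submodule.mem_span_singleton_self _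
    rw [Module.End.mem_eigenspace_iff, one_smul, Matrix.toLin'_apply] at hr
    have h4 := congrFun hr b
    simp only [Matrix.mulVec, dotProduct, Matrix.map_apply, eq_ratCast] at h4
    have h5 : ∑ a, N.productionMatrix b a * (r a : ℚ) = r b := by exact_mod_cast h4
    have hcast : ∀ a, (((r a).toNat : ℕ) : ℚ) = r a := fun a => by
      have : (((r a).toNat : ℕ) : ℤ) = r a := Int.toNat_of_nonneg (h1 a).le
      exact_mod_cast this
    simp only [Pi.smul_apply, smul_eq_mul, Nat.cast_mul, hcast] at h
    have h6 : (N.emitVec (D • fun a => (r a).toNat) q b : ℚ) = D * r b := by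
      rw [← h, ← h5, Finset.mul_sum]
      exact Finset.sum_congr rfl fun a _ => by ring
    rw [← hcast b] at h6
    simp only [Pi.smul_apply, smul_eq_mul]
    exact_mod_cast h6

/-- The weight changes by a bounded amount along any word. -/
theorem exists_weight_bound (hN : N.IsIrreducibleCritical) :
    ∃ C : ℤ, ∀ (n : Letter A → ℕ) (q : State S),
      |N.weight (natVec (N.emitVec n q)) - N.weight (natVec n)| ≤ C := by
  obtain ⟨D, hD, hmem⟩ := N.exists_period
  obtain ⟨e, he⟩ := N.exists_tVec_mem_Loc
  -- The weight gain is a cocycle over the state transitions; `hadd` is the cocycle identity.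
  let δ : (Letter A → ℕ) → State S → ℤ :=
    fun n q => N.weight (natVec (N.emitVec n q)) - N.weight (natVec n)
  have hadd : ∀ m n q, δ (m + n) q = δ m q + δ n (N.tVec m q) := by
    intro m n q
    simp only [δ, emitVec_add, natVec_add, weight_add]
    ring
  have hfin : Set.Finite {n : Letter A → ℕ | n ≤ e ⊔ fun _ => D} := Set.finite_Iic _
  obtain ⟨C, hC⟩ : ∃ C : ℤ, ∀ n ≤ e ⊔ (fun _ => D), ∀ q : State S, |δ n q| ≤ C := by
    obtain ⟨C, hC⟩ := ((hfin.prod (Set.finite_univ (α := State S))).image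
      fun p => |δ p.1 p.2|).bddAbove
    exact ⟨C, fun n hn q => hC ⟨(n, q), ⟨hn, trivial⟩, rfl⟩⟩
  -- On `Loc` the multiples of `D` contribute nothing, so only the remainder modulo `D` counts, and
  -- it lies in the finite box.
  have hloc : ∀ n, ∀ q ∈ N.Loc, |δ n q| ≤ C := by
    intro n q hq
    have hdecomp : n = D • (fun a => n a / D) + fun a => n a % D := by
      funext a; simp [Nat.div_add_mod]
    have h0 : δ (D • fun a => n a / D) q = 0 := sub_eq_zero.2 (hN.weight_emitVec (hmem _) hq)
    rw [hdecomp, hadd, h0, zero_add]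
    refine hC _ (fun a => ?_) _
    exact (Nat.mod_lt _ hD).le.trans (le_sup_right (a := e a))
  -- For a general `q`, compare processing `n` then `e` with `e` then `n`: the gain `δ n q` is a
  -- combination of three terms, each at most `C` in absolute value.
  refine ⟨3 * C, fun n q => ?_⟩
  have h1 := hadd n e q
  rw [add_comm, hadd] at h1
  have h2 := hC e le_sup_left q
  have h3 := hC e le_sup_left (N.tVec n q)
  have h4 := hloc n _ (he q)
  change |δ n q| ≤ _
  rw [abs_le] at *
  constructor <;> linarith [h2.1, h2.2, h3.1, h3.2, h4.1, h4.2]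

theorem exists_weight_fireWord_bound (hN : N.IsIrreducibleCritical) :
    ∃ C : ℤ, ∀ (w : List (Letter A)) (c : Config A S),
      |N.weight (N.fireWord w c).1 - N.weight c.1| ≤ C := by
  obtain ⟨C, hC⟩ := hN.exists_weight_bound
  refine ⟨C, fun w c => ?_⟩
  have := hC (fun a => w.count a) c.2
  rwa [fireWord_fst, weight_sub, weight_add, emitWord_eq_emitVec, add_sub_assoc,
    add_sub_cancel_left]

/-- All entries of `s` are positive integers, so a lower bound on the coordinates and an upper bound
on the weight confine the vector to a box. -/
theorem finite_of_weight_le (hN : N.IsIrreducibleCritical) (lo : Letter A → ℤ) (B : ℤ) :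
    {c : Config A S | lo ≤ c.1 ∧ N.weight c.1 ≤ B}.Finite := by
  refine ((Set.finite_Icc lo fun a => lo a + (B - N.weight lo)).prod
    (Set.finite_univ (α := State S))).subset ?_
  rintro ⟨x, q⟩ ⟨h1, h2⟩
  refine ⟨⟨h1, fun a => ?_⟩, trivial⟩
  have h3 : N.weight x - N.weight lo = ∑ a, N.exchangeRate a * (x a - lo a) := by
    rw [← weight_sub]; rfl
  have h4 : N.exchangeRate a * (x a - lo a) ≤ ∑ a, N.exchangeRate a * (x a - lo a) :=
    Finset.single_le_sum (f := fun a => N.exchangeRate a * (x a - lo a))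
      (fun b _ => mul_nonneg (hN.exchangeRate_pos b).le (sub_nonneg.2 (h1 b))) (Finset.mem_univ a)
  have h5 := hN.exchangeRate_pos a
  have h6 : 0 ≤ x a - lo a := sub_nonneg.2 (h1 a)
  simp only at h2 ⊢
  nlinarith

/-- Legality bounds the coordinates from below, and the bounded weight variation bounds the weight
from above. -/
theorem finite_reaches (hN : N.IsIrreducibleCritical) (c : Config A S) :
    {c' | N.Reaches c c'}.Finite := by
  obtain ⟨C, hC⟩ := hN.exists_weight_fireWord_bound
  refine (hN.finite_of_weight_le (fun a => min (c.1 a) 0) (N.weight c.1 + C)).subset ?_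
  intro c' h
  obtain ⟨w, hw, rfl⟩ := N.reaches_iff.1 h
  refine ⟨fun a => N.run_lower hw a, ?_⟩
  have := (abs_le.1 (hC w c)).2
  linarith

end IsIrreducibleCritical

end

end AbelianNetwork

namespace AbelianNetwork

noncomputable section

variable {V : Type*} [Fintype V] [DecidableEq V] {E : V → V → Type*} [∀ v u, Fintype (E v u)]
  {A : V → Type*} [∀ v, Fintype (A v)] [∀ v, DecidableEq (A v)]
  {S : V → Type*} [∀ v, Fintype (S v)]
  (N : AbelianNetwork V E A S)

set_option linter.unusedSectionVars false

/-! ### Closed walks and recurrence -/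

theorem reaches_of_le {c : ℕ → Config A S} (h : ∀ i, N.Reaches (c i) (c (i + 1))) {i j : ℕ}
    (hij : i ≤ j) : N.Reaches (c i) (c j) := by
  induction j, hij using Nat.le_induction with
  | base => exact Relation.ReflTransGen.refl
  | succ j _ ih => exact ih.trans (h j)

theorem reaches_of_ge {c : ℕ → Config A S} (h : ∀ i, N.Reaches (c (i + 1)) (c i)) {i j : ℕ}
    (hij : i ≤ j) : N.Reaches (c j) (c i) := by
  induction j, hij using Nat.le_induction with
  | base => exact Relation.ReflTransGen.refl
  | succ j _ ih => exact (h j).trans ih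

theorem exists_cycle_of_step {a : Letter A} {c d : Config A S} (h : N.Step a c d)
    (hr : N.Reaches d c) : ∃ v, v ≠ [] ∧ N.Run v c ∧ N.fireWord v c = c := by
  obtain ⟨w, hw, hwc⟩ := N.reaches_iff.1 hr
  rw [h.2] at hw hwc
  exact ⟨a :: w, by simp, ⟨h.1, hw⟩, hwc⟩

variable [∀ v, Nonempty (S v)]
variable {N}

namespace IsIrreducibleCritical

/-- A vector that is reproduced by its own emission involves every letter. -/
theorem pos_of_emitVec_eq_self (hN : N.IsIrreducibleCritical) {n : Letter A → ℕ} {q : State S}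
    (ht : N.tVec n q = q) (he : N.emitVec n q = n) {a : Letter A} (ha : 0 < n a) (b : Letter A) :
    0 < n b := by
  obtain ⟨D, hD, hmem⟩ := N.exists_period
  obtain ⟨e, hloc⟩ := N.exists_tVec_mem_Loc
  have hj : ∀ j : ℕ, N.tVec (j • n) q = q ∧ N.emitVec (j • n) q = j • n := by
    intro j
    induction j with
    | zero => simp only [zero_smul, tVec_zero, emitVec_zero, and_self]
    | succ j ih =>
      rw [succ_nsmul, tVec_add, emitVec_add, ih.1, ih.2, ht, he]
      exact ⟨rfl, rfl⟩
  -- The state `q` may lie outside `Loc`, where `P` says nothing. Processing `e` and `D • n` in both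
  -- orders transfers the balance to a state in `Loc`, so `D • n` is fixed by `P` and irreducibility
  -- applies.
  have h1 : N.emitVec (D • n) (N.tVec e q) = D • n := by
    have h2 := N.emitVec_add e (D • n) q
    rw [add_comm, emitVec_add, (hj D).1, (hj D).2, add_comm] at h2
    exact (add_left_cancel h2).symm
  have h3 : N.productionMatrix.mulVec (fun a => ((D • n) a : ℚ)) = fun a => ((D • n) a : ℚ) := by
    funext c
    have := N.productionMatrix_mulVec hN.locallyIrreducible (hmem n) (hloc q) c
    rw [h1] at this
    exact this
  have h4 := Matrix.pos_of_mulVec_eq_self (N.productionMatrix_nonneg hN.locallyIrreducible)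
    hN.stronglyConnected.2 (v := fun a => ((D • n) a : ℚ)) (fun i => by positivity) h3 (a := a)
    (by simp only [Pi.smul_apply, smul_eq_mul]; positivity) b
  have h5 : 0 < D * n b := by exact_mod_cast h4
  exact Nat.pos_of_mul_pos_left h5

/-- On a closed walk, legal or not, each letter is sent exactly as often as it is processed, so the
letter counts reproduce themselves. -/
theorem mem_of_cycle (hN : N.IsIrreducibleCritical) {v : List (Letter A)} {c : Config A S}
    (hv : v ≠ []) (hc : N.fireWord v c = c) (b : Letter A) : b ∈ v := by
  obtain ⟨a, ha⟩ := List.exists_mem_of_ne_nil v hv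
  have ht : N.tVec (fun a => v.count a) c.2 = c.2 := by
    rw [← tWord_eq_tVec, ← fireWord_snd, hc]
  have he : N.emitVec (fun a => v.count a) c.2 = fun a => v.count a := by
    have h1 := congrArg Prod.fst hc
    rw [fireWord_fst, emitWord_eq_emitVec] at h1
    funext b
    have h2 := congrFun h1 b
    simp only [Pi.add_apply, Pi.sub_apply, natVec] at h2
    omega
  exact List.count_pos_iff.1
    (hN.pos_of_emitVec_eq_self ht he (List.count_pos_iff.2 ha) b)

theorem mem_Loc_of_cycle (hN : N.IsIrreducibleCritical) {v : List (Letter A)} {c : Config A S}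
    (hv : v ≠ []) (hc : N.fireWord v c = c) : c.2 ∈ N.Loc := by
  refine N.mem_Loc_of_tVec_eq (n := fun a => v.count a)
    (fun a => List.count_pos_iff.2 (hN.mem_of_cycle hv hc a)) ?_
  rw [← tWord_eq_tVec, ← fireWord_snd, hc]

/-- A configuration is recurrent exactly if it lies on a closed legal walk. -/
theorem isRecurrentConfig_iff (hN : N.IsIrreducibleCritical) {c : Config A S} :
    N.IsRecurrentConfig c ↔ ∃ v, v ≠ [] ∧ N.Run v c ∧ N.fireWord v c = c := by
  refine ⟨fun h => h.exists_cycle, ?_⟩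
  rintro ⟨v, hv, hr, hc⟩
  exact N.isRecurrentConfig_of_cycle (hN.mem_of_cycle hv hc) hv hr hc

theorem mem_Loc (hN : N.IsIrreducibleCritical) {c : Config A S} (h : N.IsRecurrentConfig c) :
    c.2 ∈ N.Loc := by
  obtain ⟨v, hv, -, hc⟩ := h.exists_cycle
  exact hN.mem_Loc_of_cycle hv hc

/-- The cycle processes every letter `a`. Just after such a legal step the count of `a` is
nonnegative, and it stays so until the cycle returns to `c`. -/
theorem nonneg (hN : N.IsIrreducibleCritical) {c : Config A S} (h : N.IsRecurrentConfig c)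
    (a : Letter A) : 0 ≤ c.1 a := by
  obtain ⟨v, hv, hr, hc⟩ := h.exists_cycle
  obtain ⟨v₁, v₂, rfl⟩ := List.append_of_mem (hN.mem_of_cycle hv hc a)
  rw [run_append] at hr
  have h1 := N.run_lower hr.2.2 a
  have h2 : 0 ≤ (N.fire a (N.fireWord v₁ c)).1 a := by
    have := hr.2.1
    simp only [fire, Pi.single_eq_same]
    omega
  rw [fireWord_append] at hc
  change N.fireWord v₂ (N.fire a (N.fireWord v₁ c)) = c at hc
  rw [hc, min_eq_right h2] at h1
  exact h1

theorem _root_.AbelianNetwork.IsRecurrentConfig.not_halts {c : Config A S}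
    (h : N.IsRecurrentConfig c) :
    ¬ N.Halts c := by
  rintro ⟨d, hd, hd'⟩
  obtain ⟨⟨a, e, ha⟩, hr⟩ := h
  obtain ⟨w, hw, hwc⟩ := N.reaches_iff.1 (hr d (Reaches.legallyRelated N hd))
  obtain ⟨v, hv, h1, h2⟩ := N.exists_cycle_of_step ha
    (hr e (Reaches.legallyRelated N (Relation.ReflTransGen.single ⟨a, ha⟩)))
  cases w with
  | nil =>
    have h3 : d = c := hwc
    rw [h3] at hd'
    have := hd' a
    have := ha.1
    omega
  | cons b w =>
    have := hd' b
    have := hw.1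
    omega

/-- Only finitely many configurations are reachable, so the walk repeats one, and that configuration
lies on a closed legal walk. -/
theorem exists_recurrent_of_walk (hN : N.IsIrreducibleCritical) {c : ℕ → Config A S}
    (h : ∀ i, ∃ a, N.Step a (c i) (c (i + 1))) :
    ∃ d, N.IsRecurrentConfig d ∧ N.Reaches (c 0) d := by
  have hr : ∀ i, N.Reaches (c i) (c (i + 1)) := fun i => Relation.ReflTransGen.single (h i)
  obtain ⟨i, j, hij, heq⟩ : ∃ i j, i < j ∧ c i = c j := by
    obtain ⟨i, -, j, -, hne, heq⟩ := Set.infinite_univ.exists_ne_map_eq_of_mapsTo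
      (f := c) (t := {c' | N.Reaches (c 0) c'})
      (fun i _ => N.reaches_of_le hr (Nat.zero_le i)) (hN.finite_reaches (c 0))
    rcases lt_or_gt_of_ne hne with h | h
    · exact ⟨i, j, h, heq⟩
    · exact ⟨j, i, h, heq.symm⟩
  obtain ⟨a, ha⟩ := h i
  refine ⟨c i, hN.isRecurrentConfig_iff.2 (N.exists_cycle_of_step ha ?_),
    N.reaches_of_le hr (Nat.zero_le i)⟩
  rw [heq]
  exact N.reaches_of_le hr hij

theorem exists_recurrent_of_not_halts (hN : N.IsIrreducibleCritical) {c : Config A S}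
    (h : ¬ N.Halts c) : ∃ d, N.IsRecurrentConfig d ∧ N.Reaches c d := by
  have hstep : ∀ d : {d : Config A S // ¬ N.Halts d}, ∃ e : {d : Config A S // ¬ N.Halts d},
      ∃ a, N.Step a d.1 e.1 := fun d => by
    obtain ⟨a, ha, hn⟩ := N.exists_step_of_not_halts d.2
    exact ⟨⟨_, hn⟩, a, ha⟩
  choose f hf using hstep
  refine hN.exists_recurrent_of_walk (c := fun i => ((f^[i]) ⟨c, h⟩).1) fun i => ?_
  simp only [Function.iterate_succ_apply']
  exact hf _

/-- A component contains a diverse infinite walk exactly if it contains a recurrent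
configuration. -/
theorem isRecurrentComponent_iff (hN : N.IsIrreducibleCritical) {C : N.Component} :
    N.IsRecurrentComponent C ↔ ∃ c, N.IsRecurrentConfig c ∧ N.comp c = C := by
  have forward : ∀ (c : ℕ → Config A S) (l : ℕ → Letter A),
      (∀ i, N.Step (l i) (c i) (c (i + 1))) → N.comp (c 0) = C →
      ∃ c, N.IsRecurrentConfig c ∧ N.comp c = C := by
    intro c l h1 h2
    obtain ⟨d, hd, hr⟩ := hN.exists_recurrent_of_walk fun i => ⟨l i, h1 i⟩
    exact ⟨d, hd, by rw [← h2]; exact (N.comp_eq_iff.2 (Reaches.legallyRelated N hr)).symm⟩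
  constructor
  · rintro (⟨c, l, h1, -, h3⟩ | ⟨c, l, h1, h2, h3⟩ | ⟨c, l, h1, -, h3⟩)
    · exact forward c l h1 (h3 0)
    · have hr : ∀ i, N.Reaches (c (i + 1)) (c i) := fun i =>
        Relation.ReflTransGen.single ⟨_, h1 i⟩
      -- A backward walk has no starting point to bound it. Instead, each letter was processed
      -- somewhere in the past of `c i`, which left its count nonnegative from then on. With the
      -- weight compared to that of `c 0`, the walk lies in a finite set and repeats.
      have hnn : ∀ i a, 0 ≤ (c i).1 a := by
        intro i a
        obtain ⟨j, hj, hij⟩ := (h2 a).exists_gt i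
        obtain ⟨w, hw, hwc⟩ := N.reaches_iff.1 (N.reaches_of_ge hr hij.le)
        have h4 := N.run_lower hw a
        have h5 := h1 j
        rw [show l j = a from hj] at h5
        have h6 : 0 ≤ (c j).1 a := by
          have := h5.1
          rw [h5.2]
          simp only [fire, Pi.single_eq_same]
          omega
        rwa [hwc, min_eq_right h6] at h4
      obtain ⟨B, hB⟩ := hN.exists_weight_fireWord_bound
      have hw : ∀ i, N.weight (c i).1 ≤ N.weight (c 0).1 + B := by
        intro i
        obtain ⟨w, -, hwc⟩ := N.reaches_iff.1 (N.reaches_of_ge hr (Nat.zero_le i))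
        have := (abs_le.1 (hB w (c i))).1
        rw [hwc] at this
        linarith
      obtain ⟨i, j, hij, heq⟩ : ∃ i j, i < j ∧ c i = c j := by
        obtain ⟨i, -, j, -, hne, heq⟩ := Set.infinite_univ.exists_ne_map_eq_of_mapsTo
          (f := c) (t := {d | (0 : Letter A → ℤ) ≤ d.1 ∧ N.weight d.1 ≤ N.weight (c 0).1 + B})
          (fun i _ => ⟨hnn i, hw i⟩) (hN.finite_of_weight_le _ _)
        rcases lt_or_gt_of_ne hne with h | h
        · exact ⟨i, j, h, heq⟩
        · exact ⟨j, i, h, heq.symm⟩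
      refine ⟨c (i + 1), hN.isRecurrentConfig_iff.2 (N.exists_cycle_of_step (h1 i) ?_), h3 _⟩
      rw [heq]
      exact N.reaches_of_ge hr hij
    · exact forward (fun i => c i) (fun i => l i) (fun i => by exact_mod_cast h1 i) (h3 0)
  · rintro ⟨c, hc, rfl⟩
    obtain ⟨v, hv, hr, hcyc⟩ := hc.exists_cycle
    have hL : 0 < v.length := List.length_pos_iff.2 hv
    -- Conversely, unroll the closed walk periodically into a forward walk; it is diverse because
    -- the cycle contains every letter.
    refine Or.inl ⟨fun i => N.fireWord (v.take (i % v.length)) c,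
      fun i => v[i % v.length]'(Nat.mod_lt _ hL), fun i => ?_, fun a => ?_, fun i => ?_⟩
    · have hk := Nat.mod_lt i hL
      set k := i % v.length with hk'
      have h1 : v.take (k + 1) = v.take k ++ [v[k]] := (List.take_concat_get' v k hk).symm
      have h2 : N.Run (v.take (k + 1)) c :=
        ((N.run_append _ (v.drop (k + 1)) c).1 (by rwa [List.take_append_drop])).1
      have h3 : N.fireWord (v.take ((i + 1) % v.length)) c = N.fireWord (v.take (k + 1)) c := by
        rw [Nat.add_mod, ← hk']
        rcases Nat.lt_or_ge (k + 1) v.length with h | h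
        · rw [Nat.mod_eq_of_lt (show 1 < v.length by omega), Nat.mod_eq_of_lt h]
        · have h4 : k + 1 = v.length := by omega
          have h5 : (k + 1 % v.length) % v.length = 0 := by
            rw [Nat.add_mod_mod, h4, Nat.mod_self]
          rw [h5, h4, List.take_length, hcyc]
          rfl
      change N.Step _ _ (N.fireWord (v.take ((i + 1) % v.length)) c)
      rw [h3]
      rw [h1, run_append] at h2
      exact ⟨h2.2.1, by rw [h1, fireWord_append]; rfl⟩
    · obtain ⟨k, hk, hka⟩ := List.getElem_of_mem (hN.mem_of_cycle hv hcyc a)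
      refine Set.infinite_of_injective_forall_mem (f := fun m : ℕ => k + v.length * m) ?_ ?_
      · intro m m' h
        exact Nat.eq_of_mul_eq_mul_left hL (Nat.add_left_cancel h)
      · intro m
        simp only [Set.mem_ofPred_eq, Nat.add_mul_mod_self_left, Nat.mod_eq_of_lt hk]
        exact hka
    · refine (N.comp_eq_iff.2 (Reaches.legallyRelated N (Run.reaches N ?_))).symm
      exact ((N.run_append _ (v.drop (i % v.length)) c).1 (by rwa [List.take_append_drop])).1

/-- A configuration that does not halt is legally related to every configuration obtained from it,
legally or not. -/
theorem legallyRelated_fireWord (hN : N.IsIrreducibleCritical) {c : Config A S}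
    (h : ¬ N.Halts c) (u : List (Letter A)) : N.LegallyRelated c (N.fireWord u c) := by
  obtain ⟨d, hd, hr⟩ := hN.exists_recurrent_of_not_halts h
  obtain ⟨w, hw, rfl⟩ := N.reaches_iff.1 hr
  obtain ⟨v, hv, h1, h2⟩ := hd.exists_cycle
  -- Run to a recurrent configuration, then go round its cycle until `u` is contained in the word.
  -- Removal of `u` gives a legal run from `fireWord u c` to the same end.
  obtain ⟨h3, h4⟩ := N.run_flatten_replicate h1 h2 u.length
  have h5 : N.Run (w ++ (List.replicate u.length v).flatten) c := by
    rw [run_append]; exact ⟨hw, h3⟩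
  refine ⟨_, h5.reaches, ?_⟩
  refine N.reaches_iff.2 ⟨_, h5.diff N u, N.fireWord_diff ?_ c⟩
  exact (subperm_flatten_replicate (hN.mem_of_cycle hv h2) u).trans
    (List.sublist_append_right _ _).subperm

end IsIrreducibleCritical

end

end AbelianNetwork

namespace AbelianNetwork

noncomputable section

variable {V : Type*} [Fintype V] [DecidableEq V] {E : V → V → Type*} [∀ v u, Fintype (E v u)]
  {A : V → Type*} [∀ v, Fintype (A v)] [∀ v, DecidableEq (A v)]
  {S : V → Type*} [∀ v, Fintype (S v)]
  (N : AbelianNetwork V E A S)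

set_option linter.unusedSectionVars false

/-! ### Capacity and level -/

variable [∀ v, Nonempty (S v)]
variable {N}

namespace IsIrreducibleCritical

/-- A halting execution ends at nonpositive weight and changes the weight by a bounded amount, so
the starting weight is bounded. -/
theorem bddAbove_cpt (hN : N.IsIrreducibleCritical) (c : Config A S) :
    BddAbove {m | ∃ z : Letter A → ℤ, N.Halts (z + c.1, c.2) ∧ N.weight z = m} := by
  obtain ⟨B, hB⟩ := hN.exists_weight_fireWord_bound
  refine ⟨B - N.weight c.1, ?_⟩
  rintro _ ⟨z, ⟨d, hd, hd'⟩, rfl⟩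
  obtain ⟨w, -, rfl⟩ := N.reaches_iff.1 hd
  have h1 := (abs_le.1 (hB w (z + c.1, c.2))).1
  have h2 : N.weight (N.fireWord w (z + c.1, c.2)).1 ≤ 0 :=
    Finset.sum_nonpos fun a _ =>
      mul_nonpos_of_nonneg_of_nonpos (hN.exchangeRate_pos a).le (hd' a)
  rw [weight_add] at h1
  linarith

theorem nonempty_cpt (c : Config A S) :
    {m | ∃ z : Letter A → ℤ, N.Halts (z + c.1, c.2) ∧ N.weight z = m}.Nonempty :=
  ⟨_, -c.1, ⟨_, Relation.ReflTransGen.refl, fun a => by simp⟩, rfl⟩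

theorem weight_le_cpt (hN : N.IsIrreducibleCritical) {c : Config A S} {z : Letter A → ℤ}
    (h : N.Halts (z + c.1, c.2)) : N.weight z ≤ N.cpt c :=
  le_csSup (hN.bddAbove_cpt c) ⟨z, h, rfl⟩

theorem cpt_add_le (hN : N.IsIrreducibleCritical) (z : Letter A → ℤ) (c : Config A S) :
    N.cpt (z + c.1, c.2) ≤ N.cpt c - N.weight z := by
  refine csSup_le (nonempty_cpt _) ?_
  rintro _ ⟨y, hy, rfl⟩
  have := hN.weight_le_cpt (c := c) (z := y + z) (by rwa [add_assoc])
  rw [weight_add] at this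
  linarith

theorem cpt_add (hN : N.IsIrreducibleCritical) (z : Letter A → ℤ) (c : Config A S) :
    N.cpt (z + c.1, c.2) = N.cpt c - N.weight z := by
  refine le_antisymm (hN.cpt_add_le z c) ?_
  have := hN.cpt_add_le (-z) (z + c.1, c.2)
  simp only [neg_add_cancel_left, weight_neg] at this
  linarith

theorem lvl_add (hN : N.IsIrreducibleCritical) (z : Letter A → ℤ) (c : Config A S) :
    N.lvl (z + c.1, c.2) = N.lvl c + N.weight z := by
  rw [lvl, lvl, hN.cpt_add]; ring

/-- The network capacity is a maximum over states, so `0.q` has nonnegative level; adding letters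
raises the level by their weight. -/
theorem weight_le_lvl (hN : N.IsIrreducibleCritical) (c : Config A S) :
    N.weight c.1 ≤ N.lvl c := by
  have h1 : N.lvl c = N.lvl (0, c.2) + N.weight c.1 := by
    rw [← hN.lvl_add, add_zero]
  have h2 : N.cpt (0, c.2) ≤ N.netCpt :=
    le_ciSup (f := fun q => N.cpt (0, q)) (Set.finite_range _).bddAbove c.2
  rw [h1, lvl]
  linarith

theorem lvl_nonneg (hN : N.IsIrreducibleCritical) {c : Config A S} (h : N.IsRecurrentConfig c) :
    0 ≤ N.lvl c :=
  le_trans (Finset.sum_nonneg fun a _ => mul_nonneg (hN.exchangeRate_pos a).le (hN.nonneg h a))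
    (hN.weight_le_lvl c)

/-- Least action principle, applied to every translate: if it halts after `w`, it halts before. -/
theorem cpt_fireWord_le (hN : N.IsIrreducibleCritical) (w : List (Letter A)) (c : Config A S) :
    N.cpt (N.fireWord w c) ≤ N.cpt c := by
  refine csSup_le (nonempty_cpt _) ?_
  rintro _ ⟨z, hz, rfl⟩
  refine hN.weight_le_cpt ?_
  rw [← fireWord_add] at hz
  exact hz.of_fireWord

/-- A vector of `K ∩ ℕ^A` moves a locally recurrent configuration by a
translation. -/
theorem _root_.AbelianNetwork.fireWord_wordOf {k : Letter A → ℕ} (hk : k ∈ N.fixing)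
    {c : Config A S} (hc : c.2 ∈ N.Loc) :
    N.fireWord (wordOf k) c = (c.1 + natVec (N.emitVec k c.2) - natVec k, c.2) := by
  refine Prod.ext ?_ ?_
  · rw [fireWord_fst]
    simp only [count_wordOf]
    rfl
  · rw [fireWord_snd]
    exact hk _ hc

/-- Words act invertibly on locally recurrent configurations. -/
theorem exists_inverse (hN : N.IsIrreducibleCritical) {c : Config A S} (hc : c.2 ∈ N.Loc)
    (w : List (Letter A)) : ∃ u, N.fireWord (w ++ u) c = c := by
  obtain ⟨r, hr, hpos, he⟩ := hN.exists_period_vector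
  have hk : w.length • r ∈ N.fixing := nsmul_mem hr _
  have hek : N.emitVec (w.length • r) c.2 = w.length • r := by
    have h1 : ∀ j : ℕ, N.emitVec (j • r) c.2 = j • r := by
      intro j
      induction j with
      | zero => rw [zero_smul, emitVec_zero]
      | succ j ih => rw [succ_nsmul, emitVec_add, ih, nsmul_mem hr j _ hc, he _ hc]
    exact h1 _
  have hsub : w.Subperm (wordOf (w.length • r)) := by
    rw [List.subperm_iff_count]
    intro a
    rw [count_wordOf]
    have h1 : w.count a ≤ w.length := List.count_le_length
    have := hpos a
    simp only [Pi.smul_apply, smul_eq_mul]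
    nlinarith
  -- A multiple of the period vector that contains `w` returns the configuration to itself; the
  -- letters beyond `w` undo `w`.
  refine ⟨(wordOf (w.length • r)).diff w, ?_⟩
  rw [fireWord_append, N.fireWord_diff hsub, fireWord_wordOf hk hc, hek, add_sub_cancel_right]

theorem halts_fireWord_iff (hN : N.IsIrreducibleCritical) {c : Config A S} (hc : c.2 ∈ N.Loc)
    (w : List (Letter A)) : N.Halts (N.fireWord w c) ↔ N.Halts c := by
  refine ⟨fun h => h.of_fireWord, fun h => ?_⟩
  obtain ⟨u, hu⟩ := hN.exists_inverse hc w
  rw [← hu, fireWord_append] at h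
  exact h.of_fireWord

/-- Processing never raises the capacity, and on locally recurrent configurations it can be undone.
-/
theorem lvl_fireWord (hN : N.IsIrreducibleCritical) {c : Config A S} (hc : c.2 ∈ N.Loc)
    (w : List (Letter A)) : N.lvl (N.fireWord w c) = N.lvl c := by
  obtain ⟨u, hu⟩ := hN.exists_inverse hc w
  have h1 := hN.cpt_fireWord_le w c
  have h2 := hN.cpt_fireWord_le u (N.fireWord w c)
  rw [← fireWord_append, hu] at h2
  rw [lvl, lvl, le_antisymm h1 h2]

/-- The stoppable levels are bounded. -/
theorem finite_stop (hN : N.IsIrreducibleCritical) : N.Stop.Finite := by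
  obtain ⟨B, hB⟩ := (Set.finite_range fun q : State S => N.lvl (0, q)).bddAbove
  refine (Set.finite_Iic B.toNat).subset ?_
  rintro m ⟨c, hc, -, hm⟩
  have h1 : N.lvl c = N.lvl (0, c.2) + N.weight c.1 := by
    rw [← hN.lvl_add, add_zero]
  have h2 : N.weight c.1 ≤ 0 := Finset.sum_nonpos fun a _ =>
    mul_nonpos_of_nonneg_of_nonpos (hN.exchangeRate_pos a).le (hc a)
  have h3 : N.lvl (0, c.2) ≤ B := hB ⟨c.2, rfl⟩
  simp only [Set.mem_Iic]
  omega

/-- Bézout: the range of the weight is a subgroup of `ℤ` whose generator divides all entries of `s`,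
and these are coprime. -/
theorem exists_weight_eq (hN : N.IsIrreducibleCritical) (m : ℤ) :
    ∃ z : Letter A → ℤ, N.weight z = m := by
  obtain ⟨g, hg⟩ := Int.subgroup_cyclic (AddMonoidHom.mk' N.weight N.weight_add).range
  have hdvd : ∀ a, g ∣ N.exchangeRate a := by
    intro a
    have h1 : N.exchangeRate a ∈ (AddMonoidHom.mk' N.weight N.weight_add).range :=
      ⟨Pi.single a 1, by simp [weight, Pi.single_apply]⟩
    rw [hg, AddSubgroup.mem_closure_singleton] at h1
    obtain ⟨j, hj⟩ := h1
    exact ⟨j, by rw [← hj, smul_eq_mul, mul_comm]⟩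
  obtain ⟨j, hj⟩ : g ∣ m := by
    refine dvd_trans ?_ (one_dvd m)
    rw [← hN.isExchangeRate.2.1]
    exact Finset.dvd_gcd fun a _ => hdvd a
  have h2 : m ∈ (AddMonoidHom.mk' N.weight N.weight_add).range := by
    rw [hg, AddSubgroup.mem_closure_singleton]
    exact ⟨j, by rw [hj, smul_eq_mul, mul_comm]⟩
  exact h2

/-! ### Locally recurrent configurations with a given state -/

/-- Local irreducibility brings both states to a common one, and the word applied to `q₀` can be
undone. -/
theorem exists_fireWord_eq (hN : N.IsIrreducibleCritical) {q₀ : State S} (hq₀ : q₀ ∈ N.Loc)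
    (c : Config A S) : ∃ w x, N.fireWord w c = (x, q₀) := by
  obtain ⟨w, w', hw⟩ := hN.locallyIrreducible c.2 q₀
  obtain ⟨u, hu⟩ := hN.exists_inverse (c := (0, q₀)) hq₀ w'
  refine ⟨w ++ u, (N.fireWord (w ++ u) c).1, Prod.ext rfl ?_⟩
  rw [fireWord_snd, tWord_append, hw, ← tWord_append]
  have := congrArg Prod.snd hu
  rwa [fireWord_snd] at this

theorem subgroupIP_le (hN : N.IsIrreducibleCritical) : N.subgroupIP ≤ N.zeroWeight := by
  rintro z ⟨k, -, hz⟩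
  have h := hN.exchangeRate_mulVec fun a => (k a : ℚ)
  have h1 : ∑ a, (N.exchangeRate a : ℚ) * z a = 0 := by
    have h2 : ∀ a, (z a : ℚ) = k a - N.productionMatrix.mulVec (fun a => (k a : ℚ)) a := fun a => by
      rw [congrFun hz a, Matrix.sub_mulVec, Matrix.one_mulVec, Pi.sub_apply]
    simp only [h2, mul_sub, Finset.sum_sub_distrib, h, sub_self]
  change N.weight z = 0
  rw [weight]
  exact_mod_cast h1

/-- Two configurations with the same locally recurrent state and a common successor differ by a
vector of `(I - P) K`. -/
theorem sub_mem_subgroupIP (hN : N.IsIrreducibleCritical) {q₀ : State S} (hq₀ : q₀ ∈ N.Loc)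
    {x y : Letter A → ℤ} {w : List (Letter A)} (h : N.fireWord w (x, q₀) = (y, q₀)) :
    x - y ∈ N.subgroupIP := by
  have ht : N.tVec (fun a => w.count a) q₀ = q₀ := by
    rw [← tWord_eq_tVec, ← N.fireWord_snd w (x, q₀), h]
  have hk := N.mem_fixing_of_tVec_eq hN.locallyIrreducible ht
  refine ⟨natVec fun a => w.count a, (N.natVec_mem_totalKernel _).2 hk, ?_⟩
  have h1 := congrArg Prod.fst h
  rw [fireWord_fst, emitWord_eq_emitVec] at h1
  funext a
  have h2 := congrFun h1 a
  have h3 := N.productionMatrix_mulVec hN.locallyIrreducible hk hq₀ a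
  simp only [Pi.add_apply, Pi.sub_apply, natVec] at h2
  rw [Matrix.sub_mulVec, Matrix.one_mulVec, Pi.sub_apply]
  simp only [Matrix.mulVec, dotProduct, natVec, Int.cast_natCast, Pi.sub_apply, Int.cast_sub]
  rw [h3, ← h2]
  push_cast
  ring

theorem exists_fireWord_sub (hN : N.IsIrreducibleCritical) {q₀ : State S} (hq₀ : q₀ ∈ N.Loc)
    {z : Letter A → ℤ} (hz : z ∈ N.subgroupIP) (x : Letter A → ℤ) :
    ∃ w, N.fireWord w (x, q₀) = (x - z, q₀) := by
  obtain ⟨k, hk, hz⟩ := hz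
  obtain ⟨r, hr, hpos, he⟩ := hN.exists_period_vector
  -- `k` may have negative entries. Adding `j` copies of the period vector makes it nonnegative,
  -- since `r ≥ 1`, and does not alter `(I - P)k`, since `P r = r`.
  let j : ℕ := ∑ a, (k a).natAbs
  let n : Letter A → ℕ := fun a => (k a + j * r a).toNat
  have hn : natVec n = k + j • natVec r := by
    funext a
    have h1 : (k a).natAbs ≤ j :=
      Finset.single_le_sum (f := fun a => (k a).natAbs) (fun _ _ => Nat.zero_le _)
        (Finset.mem_univ a)
    have h2 := hpos a
    have h3 : (j : ℤ) ≤ j * r a := by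
      have : (1 : ℤ) ≤ r a := by exact_mod_cast h2
      nlinarith
    simp only [natVec, n, Pi.add_apply, nsmul_eq_mul, Pi.mul_apply, Pi.natCast_apply]
    rw [Int.toNat_of_nonneg (by omega)]
  have hn' : n ∈ N.fixing := by
    refine (N.natVec_mem_totalKernel n).1 ?_
    rw [hn]
    exact N.totalKernel.add_mem hk (nsmul_mem ((N.natVec_mem_totalKernel r).2 hr) _)
  refine ⟨wordOf n, ?_⟩
  rw [fireWord_wordOf hn' hq₀]
  refine Prod.ext (funext fun a => ?_) rfl
  have h1 := N.productionMatrix_mulVec hN.locallyIrreducible hn' hq₀ a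
  have h2 := N.productionMatrix_mulVec hN.locallyIrreducible hr hq₀ a
  rw [he _ hq₀] at h2
  have h3 := congrFun hz a
  rw [Matrix.sub_mulVec, Matrix.one_mulVec, Pi.sub_apply] at h3
  simp only [Matrix.mulVec, dotProduct] at h3
  have h4 : ∀ a, (n a : ℚ) = k a + j * r a := fun a => by
    have := congrFun hn a
    simp only [natVec, Pi.add_apply, nsmul_eq_mul, Pi.mul_apply, Pi.natCast_apply] at this
    exact_mod_cast this
  have h5 : (N.emitVec n q₀ a : ℚ) - n a = -z a := by
    rw [← h1, h3]
    simp only [h4, mul_add, Finset.sum_add_distrib]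
    have h6 : ∑ b, N.productionMatrix a b * (j * r b : ℚ) = j * r a := by
      rw [← h2, Finset.mul_sum]
      exact Finset.sum_congr rfl fun b _ => by ring
    rw [h6]; ring
  have h7 : (N.emitVec n q₀ a : ℤ) - n a = -z a := by exact_mod_cast h5
  simp only [Pi.add_apply, Pi.sub_apply, natVec]
  linarith

theorem halts_congr (hN : N.IsIrreducibleCritical) {q₀ : State S} (hq₀ : q₀ ∈ N.Loc)
    {x y : Letter A → ℤ} (h : x - y ∈ N.subgroupIP) : N.Halts (x, q₀) ↔ N.Halts (y, q₀) := by
  obtain ⟨w, hw⟩ := hN.exists_fireWord_sub hq₀ h x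
  rw [sub_sub_cancel] at hw
  rw [← hw]
  exact (hN.halts_fireWord_iff (c := (x, q₀)) hq₀ w).symm

/-- The components of the nonhalting configurations with state `q₀` are separated by the classes
modulo `(I - P) K`. -/
theorem comp_eq_iff_sub_mem (hN : N.IsIrreducibleCritical) {q₀ : State S} (hq₀ : q₀ ∈ N.Loc)
    {x y : Letter A → ℤ} (hx : ¬ N.Halts (x, q₀)) :
    N.comp (x, q₀) = N.comp (y, q₀) ↔ x - y ∈ N.subgroupIP := by
  constructor
  · intro h
    obtain ⟨d, h1, h2⟩ := N.comp_eq_iff.1 h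
    obtain ⟨w, -, hw⟩ := N.reaches_iff.1 h1
    obtain ⟨w', -, hw'⟩ := N.reaches_iff.1 h2
    obtain ⟨u, hu⟩ := hN.exists_inverse (c := (y, q₀)) hq₀ w'
    refine hN.sub_mem_subgroupIP hq₀ (w := w ++ u) ?_
    rw [fireWord_append, hw, ← hw', ← fireWord_append, hu]
  · intro h
    obtain ⟨w, hw⟩ := hN.exists_fireWord_sub hq₀ h x
    rw [sub_sub_cancel] at hw
    rw [← hw]
    exact N.comp_eq_iff.2 (hN.legallyRelated_fireWord hx w)

theorem isRecurrentComponent_comp (hN : N.IsIrreducibleCritical) {c : Config A S}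
    (h : ¬ N.Halts c) : N.IsRecurrentComponent (N.comp c) := by
  obtain ⟨d, hd, hr⟩ := hN.exists_recurrent_of_not_halts h
  exact hN.isRecurrentComponent_iff.2 ⟨d, hd, (N.comp_eq_iff.2 hr.legallyRelated).symm⟩

/-- Every recurrent component contains a nonhalting configuration with state `q₀`. -/
theorem exists_comp_eq (hN : N.IsIrreducibleCritical) {q₀ : State S} (hq₀ : q₀ ∈ N.Loc)
    (C : N.Lrec) : ∃ x : Letter A → ℤ, ¬ N.Halts (x, q₀) ∧ N.comp (x, q₀) = C.1 := by
  obtain ⟨c, hc, hC⟩ := hN.isRecurrentComponent_iff.1 C.2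
  obtain ⟨w, x, hw⟩ := hN.exists_fireWord_eq hq₀ c
  refine ⟨x, ?_, ?_⟩
  · rw [← hw, hN.halts_fireWord_iff (hN.mem_Loc hc)]
    exact hc.not_halts
  · rw [← hw, ← hC]
    exact (N.comp_eq_iff.2 (hN.legallyRelated_fireWord hc.not_halts w)).symm

/-- The level is constant along words only on locally recurrent states, whence the two hypotheses on
the states. -/
theorem lvl_eq_of_comp_eq (hN : N.IsIrreducibleCritical) {c d : Config A S} (hc : c.2 ∈ N.Loc)
    (hd : d.2 ∈ N.Loc) (h : N.comp c = N.comp d) : N.lvl c = N.lvl d := by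
  obtain ⟨e, h1, h2⟩ := N.comp_eq_iff.1 h
  obtain ⟨w, -, rfl⟩ := N.reaches_iff.1 h1
  obtain ⟨w', -, hw'⟩ := N.reaches_iff.1 h2
  rw [← hN.lvl_fireWord hc w, ← hw', hN.lvl_fireWord hd]

theorem mem_lrecLevel_iff (hN : N.IsIrreducibleCritical) {c : Config A S} (hc : c.2 ∈ N.Loc)
    {C : N.Lrec} (hC : N.comp c = C.1) (m : ℕ) : C ∈ N.LrecLevel m ↔ N.lvl c = m := by
  constructor
  · rintro ⟨d, hd, hdC, hm⟩
    rw [← hm]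
    exact hN.lvl_eq_of_comp_eq hc (hN.mem_Loc hd) (hC.trans hdC.symm)
  · intro hm
    obtain ⟨d, hd, hdC⟩ := hN.isRecurrentComponent_iff.1 C.2
    exact ⟨d, hd, hdC, by
      rw [← hm]; exact hN.lvl_eq_of_comp_eq (hN.mem_Loc hd) hc (hdC.trans hC.symm)⟩

theorem exists_mem_lrecLevel (hN : N.IsIrreducibleCritical) (C : N.Lrec) :
    ∃ m : ℕ, C ∈ N.LrecLevel m := by
  obtain ⟨d, hd, hdC⟩ := hN.isRecurrentComponent_iff.1 C.2
  exact ⟨(N.lvl d).toNat, d, hd, hdC, (Int.toNat_of_nonneg (hN.lvl_nonneg hd)).symm⟩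

/-- A level is stoppable exactly if a halting configuration with state `q₀` has that level. -/
theorem mem_stop_iff (hN : N.IsIrreducibleCritical) {q₀ : State S} (hq₀ : q₀ ∈ N.Loc) (m : ℕ) :
    m ∈ N.Stop ↔ ∃ x : Letter A → ℤ, N.Halts (x, q₀) ∧ N.lvl (x, q₀) = m := by
  constructor
  · rintro ⟨c, hc, hloc, hm⟩
    obtain ⟨w, x, hw⟩ := hN.exists_fireWord_eq hq₀ c
    refine ⟨x, ?_, ?_⟩
    · rw [← hw, hN.halts_fireWord_iff hloc]
      exact ⟨c, Relation.ReflTransGen.refl, hc⟩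
    · rw [← hw, hN.lvl_fireWord hloc, hm]
  · rintro ⟨x, ⟨d, hd, hd'⟩, hm⟩
    obtain ⟨w, -, rfl⟩ := N.reaches_iff.1 hd
    refine ⟨_, hd', ?_, ?_⟩
    · rw [fireWord_snd, tWord_eq_tVec]
      exact N.tVec_mem_Loc _ hq₀
    · rw [hN.lvl_fireWord (c := (x, q₀)) hq₀, hm]

/-! ### The image of `I - P` and the torsion of the quotient -/

/-- Every rational left eigenvector of `P` for the eigenvalue `1` is a multiple of `s`. -/
theorem exists_eq_mul_exchangeRate (hN : N.IsIrreducibleCritical) {v : Letter A → ℚ}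
    (hv : ∀ a, ∑ b, v b * N.productionMatrix b a = v a) :
    ∃ c : ℚ, ∀ a, v a = c * N.exchangeRate a := by
  obtain ⟨a₀⟩ := hN.stronglyConnected.1
  have h : (fun a => (v a : ℝ)) ∈ Module.End.eigenspace
      (Matrix.toLin' (N.productionMatrix.transpose.map (algebraMap ℚ ℝ))) 1 := by
    rw [Module.End.mem_eigenspace_iff, one_smul, Matrix.toLin'_apply]
    funext a
    simp only [Matrix.mulVec, dotProduct, Matrix.map_apply, Matrix.transpose_apply, eq_ratCast]
    rw [← hv a]
    push_cast
    exact Finset.sum_congr rfl fun b _ => mul_comm _ _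
  rw [hN.eigenspace_transpose, Submodule.mem_span_singleton] at h
  obtain ⟨c, hc⟩ := h
  have hc' : ∀ a, (v a : ℝ) = c * N.exchangeRate a := fun a => (congrFun hc a).symm
  have hs : (N.exchangeRate a₀ : ℝ) ≠ 0 := by exact_mod_cast (hN.exchangeRate_pos a₀).ne'
  refine ⟨v a₀ / N.exchangeRate a₀, fun a => ?_⟩
  have h1 : (v a : ℝ) = v a₀ / N.exchangeRate a₀ * N.exchangeRate a := by
    rw [hc' a, hc' a₀, mul_div_cancel_right₀ _ hs]
  exact_mod_cast h1

/-- `I - P` maps onto the rational vectors of weight zero. -/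
theorem exists_mulVec_eq (hN : N.IsIrreducibleCritical) {z : Letter A → ℚ}
    (hz : ∑ a, (N.exchangeRate a : ℚ) * z a = 0) :
    ∃ v : Letter A → ℚ, (1 - N.productionMatrix).mulVec v = z := by
  by_contra hne
  have hz' : z ∉ LinearMap.range (Matrix.toLin' (1 - N.productionMatrix)) := by
    rintro ⟨v, hv⟩
    exact hne ⟨v, by rwa [Matrix.toLin'_apply] at hv⟩
  -- Duality: a functional that vanishes on the image of `I - P` is a left eigenvector of `P`, hence
  -- a multiple of `s`, hence vanishes at `z`.
  obtain ⟨l, hl, hle⟩ := Submodule.exists_le_ker_of_notMem hz'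
  have hsum : ∀ y : Letter A → ℚ, l y = ∑ a, y a * l (Pi.single a 1) := fun y => by
    rw [LinearMap.pi_apply_eq_sum_univ l y]
    refine Finset.sum_congr rfl fun a _ => ?_
    rw [smul_eq_mul]
    congr 2
    funext b
    simp [Pi.single_apply, eq_comm]
  obtain ⟨c, hc⟩ := hN.exists_eq_mul_exchangeRate (v := fun a => l (Pi.single a 1)) fun a => by
    have h1 : l (Matrix.toLin' (1 - N.productionMatrix) (Pi.single a 1)) = 0 :=
      LinearMap.mem_ker.1 (hle ⟨_, rfl⟩)
    rw [Matrix.toLin'_apply, Matrix.sub_mulVec, Matrix.one_mulVec, map_sub, sub_eq_zero,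
      hsum (N.productionMatrix.mulVec _)] at h1
    rw [h1]
    exact Finset.sum_congr rfl fun b _ => by simp [mul_comm]
  apply hl
  rw [hsum]
  simp only [hc]
  rw [← mul_zero c, ← hz, Finset.mul_sum]
  exact Finset.sum_congr rfl fun a _ => by ring

/-- The quotient of `ℤ^A_0` by `(I - P) K` is a torsion group. -/
theorem exists_nsmul_mem_subgroupIP (hN : N.IsIrreducibleCritical) {z : Letter A → ℤ}
    (hz : z ∈ N.zeroWeight) : ∃ D : ℕ, 0 < D ∧ D • z ∈ N.subgroupIP := by
  have hz' : ∑ a, N.exchangeRate a * z a = 0 := hz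
  obtain ⟨v, hv⟩ := hN.exists_mulVec_eq (z := fun a => (z a : ℚ)) (by exact_mod_cast hz')
  obtain ⟨⟨b, hb⟩, hint⟩ := IsLocalization.exist_integer_multiples_of_finite
    (nonZeroDivisors ℤ) v
  choose k hk using hint
  have hk' : ∀ i, (k i : ℚ) = b * v i := fun i => by simpa [zsmul_eq_mul] using hk i
  have hb0 : b ≠ 0 := nonZeroDivisors.ne_zero hb
  obtain ⟨D, hD, hmem⟩ := N.exists_period
  -- The factor `b` clears the denominators of the rational preimage; the common period `D` then
  -- moves the integer vector into `K`.
  have hK : D • k ∈ N.totalKernel := by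
    have h1 : D • k = natVec (D • posPart k) - natVec (D • negPart k) := by
      funext a
      simp only [natVec, posPart, negPart, Pi.sub_apply, Pi.smul_apply,
        nsmul_eq_mul, Pi.mul_apply, Pi.natCast_apply]
      push_cast
      rw [← mul_sub]
      congr 1
      omega
    rw [h1]
    exact N.totalKernel.sub_mem ((N.natVec_mem_totalKernel _).2 (hmem _))
      ((N.natVec_mem_totalKernel _).2 (hmem _))
  have hmemb : (D * b : ℤ) • z ∈ N.subgroupIP := by
    refine ⟨D • k, hK, ?_⟩
    have h2 : (fun a => (((D • k) a : ℤ) : ℚ)) = (D * b : ℚ) • v := by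
      funext a
      simp only [Pi.smul_apply, nsmul_eq_mul, smul_eq_mul]
      push_cast
      rw [hk' a]; ring
    rw [h2, Matrix.mulVec_smul, hv]
    funext a
    simp
  refine ⟨(D * b : ℤ).natAbs, Int.natAbs_pos.2 (mul_ne_zero (by exact_mod_cast hD.ne') hb0), ?_⟩
  rw [← natCast_zsmul]
  rcases Int.natAbs_eq (D * b : ℤ) with h | h
  · rwa [← h]
  · rw [h, neg_smul] at hmemb
    exact neg_mem_iff.1 hmemb

end IsIrreducibleCritical

end

end AbelianNetwork

namespace AbelianNetwork

noncomputable section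

variable {V : Type*} [Fintype V] [DecidableEq V] {E : V → V → Type*} [∀ v u, Fintype (E v u)]
  {A : V → Type*} [∀ v, Fintype (A v)] [∀ v, DecidableEq (A v)]
  {S : V → Type*} [∀ v, Fintype (S v)]
  (N : AbelianNetwork V E A S)

set_option linter.unusedSectionVars false

/-! ### The shift monoid in coordinates -/

variable [∀ v, Nonempty (S v)]

/-- A locally recurrent state. -/
def baseState : State S := N.Loc_nonempty.some

theorem baseState_mem : N.baseState ∈ N.Loc := N.Loc_nonempty.some_mem

theorem natVec_posPart_sub (z : Letter A → ℤ) : natVec (posPart z) - natVec (negPart z) = z := by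
  funext a
  simp only [natVec, posPart, negPart, Pi.sub_apply]
  omega

theorem shift_mul (m n : Letter A → ℕ) : N.shift m * N.shift n = N.shift (m + n) :=
  Subtype.ext (map_mul N.phi (Multiplicative.ofAdd m) (Multiplicative.ofAdd n)).symm

theorem exists_shift_eq (f : N.Mon) : ∃ n, f = N.shift n := by
  obtain ⟨_, n, rfl⟩ := f
  exact ⟨n.toAdd, rfl⟩

theorem exists_frac_eq (g : N.Grt) : ∃ n n', g = N.frac n n' := by
  induction g using Localization.induction_on with
  | H y =>
    obtain ⟨a, b, hb⟩ := y
    obtain ⟨n, rfl⟩ := N.exists_shift_eq a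
    obtain ⟨n', rfl⟩ := N.exists_shift_eq b
    exact ⟨n, n', rfl⟩

theorem frac_mul (m m' n n' : Letter A → ℕ) :
    N.frac m m' * N.frac n n' = N.frac (m + n) (m' + n') := by
  rw [frac, frac, Localization.mk_mul, shift_mul]
  exact congrArg _ (Subtype.ext (N.shift_mul m' n'))

theorem frac_zero : N.frac 0 0 = 1 := by
  have h : N.shift 0 = 1 := Subtype.ext (map_one N.phi)
  rw [frac, ← Localization.mk_one]
  exact congrArg₂ _ h (Subtype.ext h)

variable {N}

namespace IsIrreducibleCritical

/-- The coordinate vector of a recurrent component: an `x` such that `x.q₀` is a nonhalting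
configuration of the component, for the base state `q₀`. -/
def coord (hN : N.IsIrreducibleCritical) (C : N.Lrec) : Letter A → ℤ :=
  (hN.exists_comp_eq N.baseState_mem C).choose

theorem not_halts_coord (hN : N.IsIrreducibleCritical) (C : N.Lrec) :
    ¬ N.Halts (hN.coord C, N.baseState) :=
  (hN.exists_comp_eq N.baseState_mem C).choose_spec.1

theorem comp_coord (hN : N.IsIrreducibleCritical) (C : N.Lrec) :
    N.comp (hN.coord C, N.baseState) = C.1 :=
  (hN.exists_comp_eq N.baseState_mem C).choose_spec.2

/-- The class of a vector modulo `(I - P) K`. -/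
def _root_.AbelianNetwork.cls (N : AbelianNetwork V E A S) :
    (Letter A → ℤ) →+ (Letter A → ℤ) ⧸ N.subgroupIP :=
  QuotientAddGroup.mk' N.subgroupIP

theorem _root_.AbelianNetwork.cls_eq_iff {x y : Letter A → ℤ} :
    N.cls x = N.cls y ↔ x - y ∈ N.subgroupIP :=
  QuotientAddGroup.eq_iff_sub_mem

/-- Adding letters keeps `coord C` nonhalting, so equality of shifted components can be tested
modulo `(I - P)K`. -/
theorem shift_eq_iff (hN : N.IsIrreducibleCritical) (n n' : Letter A → ℕ) (C C' : N.Lrec) :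
    (N.shift n).1 C = (N.shift n').1 C' ↔
      N.cls (hN.coord C) + N.cls (natVec n) = N.cls (hN.coord C') + N.cls (natVec n') := by
  have h1 : ∀ (n : Letter A → ℕ) (C : N.Lrec),
      ((N.shift n).1 C).1 = N.comp (natVec n + hN.coord C, N.baseState) := by
    intro n C
    change N.shiftComp n C.1 = _
    rw [← hN.comp_coord C, add_comm]
    rfl
  have h2 : ¬ N.Halts (natVec n + hN.coord C, N.baseState) :=
    N.not_halts_add (hN.not_halts_coord C) fun a => Int.natCast_nonneg _
  rw [Subtype.ext_iff, h1, h1, hN.comp_eq_iff_sub_mem N.baseState_mem h2, ← cls_eq_iff,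
    map_add, map_add, add_comm, add_comm (N.cls (natVec n'))]

theorem coord_injective (hN : N.IsIrreducibleCritical) {C C' : N.Lrec}
    (h : N.cls (hN.coord C) = N.cls (hN.coord C')) : C = C' := by
  rw [cls_eq_iff, ← hN.comp_eq_iff_sub_mem N.baseState_mem (hN.not_halts_coord C),
    hN.comp_coord, hN.comp_coord] at h
  exact Subtype.ext h

theorem exists_coord_eq (hN : N.IsIrreducibleCritical) {x : Letter A → ℤ}
    (hx : ¬ N.Halts (x, N.baseState)) : ∃ C : N.Lrec, N.cls (hN.coord C) = N.cls x := by
  refine ⟨⟨N.comp (x, N.baseState), hN.isRecurrentComponent_comp hx⟩, ?_⟩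
  rw [cls_eq_iff, ← hN.comp_eq_iff_sub_mem N.baseState_mem (hN.not_halts_coord _), hN.comp_coord]

theorem lvl_coord (hN : N.IsIrreducibleCritical) (x : Letter A → ℤ) :
    N.lvl (x, N.baseState) = N.lvl (0, N.baseState) + N.weight x := by
  rw [← hN.lvl_add, add_zero]

theorem mem_lrecLevel_iff_coord (hN : N.IsIrreducibleCritical) (C : N.Lrec) (m : ℕ) :
    C ∈ N.LrecLevel m ↔ N.lvl (hN.coord C, N.baseState) = m :=
  hN.mem_lrecLevel_iff N.baseState_mem (hN.comp_coord C) m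

theorem nonempty_lrecLevel (hN : N.IsIrreducibleCritical) {m : ℕ} (hm : m ∉ N.Stop) :
    (N.LrecLevel m).Nonempty := by
  obtain ⟨x, hx⟩ := hN.exists_weight_eq (m - N.lvl (0, N.baseState))
  have hl : N.lvl (x, N.baseState) = m := by rw [hN.lvl_coord, hx]; ring
  have hh : ¬ N.Halts (x, N.baseState) := fun h =>
    hm ((hN.mem_stop_iff N.baseState_mem m).2 ⟨x, h, hl⟩)
  exact ⟨⟨_, hN.isRecurrentComponent_comp hh⟩,
    (hN.mem_lrecLevel_iff (c := (x, N.baseState)) N.baseState_mem rfl m).2 hl⟩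

theorem nonempty_lrec (hN : N.IsIrreducibleCritical) : Nonempty N.Lrec := by
  obtain ⟨m, hm⟩ := hN.finite_stop.exists_notMem
  exact ⟨(hN.nonempty_lrecLevel hm).some⟩

/-- The forward direction cancels a coordinate, so it needs some recurrent component to exist; any
unstoppable level supplies one. -/
theorem shift_eq_shift_iff (hN : N.IsIrreducibleCritical) (n n' : Letter A → ℕ) :
    N.shift n = N.shift n' ↔ N.cls (natVec n) = N.cls (natVec n') := by
  constructor
  · intro h
    obtain ⟨C⟩ := hN.nonempty_lrec
    have h1 : (N.shift n).1 C = (N.shift n').1 C := by rw [h]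
    exact add_left_cancel ((hN.shift_eq_iff n n' C C).1 h1)
  · intro h
    exact Subtype.ext (funext fun C => (hN.shift_eq_iff n n' C C).2 (by rw [h]))

/-- The shift monoid embeds in a group, so the auxiliary factor in the equality of fractions
cancels. -/
theorem frac_eq_frac_iff (hN : N.IsIrreducibleCritical) (m m' n n' : Letter A → ℕ) :
    N.frac m m' = N.frac n n' ↔
      N.cls (natVec m - natVec m') = N.cls (natVec n - natVec n') := by
  have key : ∀ l : Letter A → ℕ, N.shift l * (N.shift n' * N.shift m) =
      N.shift l * (N.shift m' * N.shift n) ↔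
        N.cls (natVec m - natVec m') = N.cls (natVec n - natVec n') := by
    intro l
    rw [shift_mul, shift_mul, shift_mul, shift_mul, hN.shift_eq_shift_iff]
    simp only [natVec_add, map_add, map_sub]
    rw [add_right_inj, sub_eq_sub_iff_add_eq_add, add_comm, add_comm (N.cls (natVec n))]
  rw [frac, frac, Localization.mk_eq_mk_iff, Localization.r_iff_exists]
  constructor
  · rintro ⟨⟨c, hc⟩, h⟩
    obtain ⟨l, rfl⟩ := N.exists_shift_eq c
    exact (key l).1 h
  · intro h
    exact ⟨⟨N.shift 0, trivial⟩, (key 0).2 h⟩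

theorem frac_pow (n n' : Letter A → ℕ) (k : ℕ) : N.frac n n' ^ k = N.frac (k • n) (k • n') := by
  induction k with
  | zero => rw [pow_zero, zero_smul, zero_smul, frac_zero]
  | succ k ih => rw [pow_succ, ih, frac_mul, succ_nsmul, succ_nsmul]

/-- The weight factors through the quotient by `(I - P)K` and takes values in the torsion-free group
`ℤ`; conversely, a vector of weight zero has a positive multiple in `(I - P)K`. -/
theorem frac_mem_tor_iff (hN : N.IsIrreducibleCritical) (n n' : Letter A → ℕ) :
    N.frac n n' ∈ N.Tor ↔ natVec n - natVec n' ∈ N.zeroWeight := by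
  have h1 : ∀ k : ℕ, N.frac n n' ^ k = 1 ↔ k • (natVec n - natVec n') ∈ N.subgroupIP := by
    intro k
    have h2 : ∀ n : Letter A → ℕ, natVec (k • n) = k • natVec n := fun n => by
      funext a; simp [natVec]
    rw [frac_pow, ← frac_zero, hN.frac_eq_frac_iff, sub_self, cls_eq_iff, sub_zero, h2, h2,
      smul_sub]
  rw [CommGroup.mem_torsion, isOfFinOrder_iff_pow_eq_one]
  constructor
  · rintro ⟨k, hk, h⟩
    have h2 : N.weight (k • (natVec n - natVec n')) = 0 := hN.subgroupIP_le ((h1 k).1 h)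
    have h3 : N.weight (k • (natVec n - natVec n')) = k * N.weight (natVec n - natVec n') := by
      simp only [weight, Finset.mul_sum, Pi.smul_apply, nsmul_eq_mul]
      exact Finset.sum_congr rfl fun a _ => by simp; ring
    rw [h3] at h2
    exact (mul_eq_zero.1 h2).resolve_left (by exact_mod_cast hk.ne')
  · intro h
    obtain ⟨D, hD, hmem⟩ := hN.exists_nsmul_mem_subgroupIP h
    exact ⟨D, hD, (h1 D).2 hmem⟩

/-- The homomorphism `ℤ^A_0 → Tor(N)` induced by `φ`. -/
def toTor (hN : N.IsIrreducibleCritical) : N.zeroWeight →+ Additive N.Tor where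
  toFun z := Additive.ofMul ⟨N.frac (posPart z.1) (negPart z.1), by
    rw [hN.frac_mem_tor_iff, natVec_posPart_sub]; exact z.2⟩
  map_zero' := Subtype.ext N.frac_zero
  map_add' z z' := Subtype.ext (by
    change N.frac _ _ = N.frac _ _ * N.frac _ _
    rw [frac_mul, hN.frac_eq_frac_iff]
    simp only [natVec_add, map_sub, map_add]
    have h := fun z : Letter A → ℤ => congrArg N.cls (natVec_posPart_sub z)
    simp only [map_sub] at h
    rw [h, add_sub_add_comm, h, h]
    exact map_add N.cls _ _)

theorem toTor_eq (hN : N.IsIrreducibleCritical) (n n' : Letter A → ℕ)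
    (h : natVec n - natVec n' ∈ N.zeroWeight) :
    ((hN.toTor ⟨_, h⟩).toMul : N.Grt) = N.frac n n' := by
  change N.frac _ _ = _
  rw [hN.frac_eq_frac_iff, natVec_posPart_sub]

theorem exists_tor_equiv (hN : N.IsIrreducibleCritical) :
    ∃ f : (N.zeroWeight ⧸ N.subgroupIP.addSubgroupOf N.zeroWeight) ≃+ Additive N.Tor,
      ∀ z : N.zeroWeight, f (QuotientAddGroup.mk z) = hN.toTor z := by
  have hsurj : Function.Surjective hN.toTor := by
    rintro ⟨g, hg⟩
    obtain ⟨n, n', rfl⟩ := N.exists_frac_eq g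
    exact ⟨⟨_, (hN.frac_mem_tor_iff n n').1 hg⟩, Subtype.ext (hN.toTor_eq n n' _)⟩
  have hker : N.subgroupIP.addSubgroupOf N.zeroWeight = hN.toTor.ker := by
    ext z
    rw [AddSubgroup.mem_addSubgroupOf, AddMonoidHom.mem_ker]
    have h1 : hN.toTor z = 0 ↔ N.frac (posPart z.1) (negPart z.1) = N.frac 0 0 := by
      rw [frac_zero]
      exact Subtype.ext_iff
    rw [h1, hN.frac_eq_frac_iff, natVec_posPart_sub, sub_self, cls_eq_iff, sub_zero]
  exact ⟨(QuotientAddGroup.quotientAddEquivOfEq hker).trans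
    (QuotientAddGroup.quotientKerEquivOfSurjective hN.toTor hsurj), fun z => rfl⟩

/-! ### Invertible components -/

/-- The component demanded by the definition must have coordinate class `coord C + z` with `z = n -
n'`, and it exists exactly if that vector does not halt. As the torsion class varies, `z` runs
through `ℤ^A_0`. -/
theorem invertible_iff_not_halts (hN : N.IsIrreducibleCritical) (C : N.Lrec) :
    N.Invertible C ↔ ∀ z ∈ N.zeroWeight, ¬ N.Halts (hN.coord C + z, N.baseState) := by
  constructor
  · intro h z hz
    obtain ⟨C', hC'⟩ := h (N.frac (posPart z) (negPart z))
      (by rwa [hN.frac_mem_tor_iff, natVec_posPart_sub]) _ _ rfl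
    have h1 := (hN.shift_eq_iff _ _ C C').1 hC'
    have h2 : N.cls (hN.coord C + z) = N.cls (hN.coord C') := by
      rw [map_add, ← congrArg N.cls (natVec_posPart_sub z), map_sub, ← add_sub_assoc, h1,
        add_sub_cancel_right]
    rw [hN.halts_congr N.baseState_mem (cls_eq_iff.1 h2)]
    exact hN.not_halts_coord C'
  · intro h g hg n n' hgn
    subst hgn
    obtain ⟨C', hC'⟩ := hN.exists_coord_eq (h _ ((hN.frac_mem_tor_iff n n').1 hg))
    refine ⟨C', (hN.shift_eq_iff n n' C C').2 ?_⟩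
    rw [hC', map_add, map_sub]
    abel

/-- The vectors `coord C + z` with `z` of weight zero are exactly those that have level `m` with the
base state. -/
theorem invertible_iff_notMem_stop (hN : N.IsIrreducibleCritical) {C : N.Lrec} {m : ℕ}
    (hC : C ∈ N.LrecLevel m) : N.Invertible C ↔ m ∉ N.Stop := by
  rw [hN.mem_lrecLevel_iff_coord] at hC
  rw [hN.invertible_iff_not_halts, hN.mem_stop_iff N.baseState_mem]
  push Not
  constructor
  · intro h x hx hl
    refine h (x - hN.coord C) ?_ (by rwa [add_sub_cancel])
    change N.weight _ = 0
    rw [hN.lvl_coord] at hC hl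
    rw [weight_sub]
    linarith
  · intro h z hz hh
    have hz' : N.weight z = 0 := hz
    refine h _ hh ?_
    rw [hN.lvl_coord] at hC ⊢
    rw [weight_add, hz']
    linarith

theorem setOf_invertible_eq (hN : N.IsIrreducibleCritical) :
    {C : N.Lrec | N.Invertible C} = ⋃ m ∈ {m : ℕ | m ∉ N.Stop}, N.LrecLevel m := by
  ext C
  simp only [Set.mem_ofPred_eq, Set.mem_iUnion, exists_prop]
  constructor
  · intro h
    obtain ⟨m, hm⟩ := hN.exists_mem_lrecLevel C
    exact ⟨m, (hN.invertible_iff_notMem_stop hm).1 h, hm⟩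
  · rintro ⟨m, hm, hC⟩
    exact (hN.invertible_iff_notMem_stop hC).2 hm

theorem pairwise_disjoint_lrecLevel (hN : N.IsIrreducibleCritical) :
    Pairwise fun m m' => Disjoint (N.LrecLevel m) (N.LrecLevel m') := by
  intro m m' hne
  rw [Set.disjoint_left]
  intro C h h'
  rw [hN.mem_lrecLevel_iff_coord] at h h'
  rw [h] at h'
  exact hne (by exact_mod_cast h')

/-! ### The action of the torsion group -/

/-- In coordinates, the class of `(φ(n), φ(n'))` acts as the translation by `n - n'`. -/
theorem isTorAction_iff (hN : N.IsIrreducibleCritical) (act : MulAction N.Tor N.InvLrec) :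
    N.IsTorAction act ↔ ∀ (g : N.Tor) (C : N.InvLrec) (n n' : Letter A → ℕ),
      (g : N.Grt) = N.frac n n' →
        N.cls (hN.coord (act.smul g C).1) = N.cls (hN.coord C.1) +
          N.cls (natVec n - natVec n') := by
  refine forall_congr' fun g => forall_congr' fun C => forall_congr' fun n =>
    forall_congr' fun n' => imp_congr_right fun _ => ?_
  rw [hN.shift_eq_iff, map_sub, ← add_sub_assoc, eq_sub_iff_add_eq, eq_comm]

/-- Translation preserves invertibility because `ℤ^A_0` is closed under addition, and it depends
only on `g` because equal fractions have equal differences modulo `(I - P)K`. -/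
theorem exists_translate (hN : N.IsIrreducibleCritical) (g : N.Tor) (C : N.InvLrec) :
    ∃ C' : N.InvLrec, ∀ n n' : Letter A → ℕ, (g : N.Grt) = N.frac n n' →
      N.cls (hN.coord C'.1) = N.cls (hN.coord C.1) + N.cls (natVec n - natVec n') := by
  obtain ⟨m, m', hm⟩ := N.exists_frac_eq g.1
  have hz : natVec m - natVec m' ∈ N.zeroWeight :=
    (hN.frac_mem_tor_iff m m').1 (by rw [← hm]; exact g.2)
  have hC := (hN.invertible_iff_not_halts C.1).1 C.2
  obtain ⟨C', hC'⟩ := hN.exists_coord_eq (hC _ hz)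
  refine ⟨⟨C', (hN.invertible_iff_not_halts C').2 fun z hz' => ?_⟩, fun n n' hn => ?_⟩
  · rw [hN.halts_congr N.baseState_mem (y := hN.coord C.1 + (natVec m - natVec m') + z)
      (by rw [add_sub_add_right_eq_sub]; exact cls_eq_iff.1 hC'), add_assoc]
    exact hC _ (N.zeroWeight.add_mem hz hz')
  · rw [hC', map_add, (hN.frac_eq_frac_iff m m' n n').1 (hm.symm.trans hn)]

theorem invLrec_ext (hN : N.IsIrreducibleCritical) {C C' : N.InvLrec}
    (h : N.cls (hN.coord C.1) = N.cls (hN.coord C'.1)) : C = C' :=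
  Subtype.ext (hN.coord_injective h)

/-- The translate of an invertible component by an element of the torsion group. -/
def translate (hN : N.IsIrreducibleCritical) (g : N.Tor) (C : N.InvLrec) : N.InvLrec :=
  (hN.exists_translate g C).choose

theorem cls_translate (hN : N.IsIrreducibleCritical) {g : N.Tor} (C : N.InvLrec)
    {n n' : Letter A → ℕ} (h : (g : N.Grt) = N.frac n n') :
    N.cls (hN.coord (hN.translate g C).1) =
      N.cls (hN.coord C.1) + N.cls (natVec n - natVec n') :=
  (hN.exists_translate g C).choose_spec n n' h

/-- The action of the torsion group on the invertible recurrent components. -/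
abbrev torAction (hN : N.IsIrreducibleCritical) : MulAction N.Tor N.InvLrec where
  smul := hN.translate
  one_smul C := hN.invLrec_ext (by
    change N.cls (hN.coord (hN.translate 1 C).1) = _
    rw [hN.cls_translate C (n := 0) (n' := 0) N.frac_zero.symm, sub_self, map_zero, add_zero])
  mul_smul g h C := hN.invLrec_ext (by
    change N.cls (hN.coord (hN.translate (g * h) C).1) =
      N.cls (hN.coord (hN.translate g (hN.translate h C)).1)
    obtain ⟨n, n', hn⟩ := N.exists_frac_eq g.1
    obtain ⟨m, m', hm⟩ := N.exists_frac_eq h.1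
    have hgh : ((g * h : N.Tor) : N.Grt) = N.frac (n + m) (n' + m') := by
      rw [← frac_mul, ← hn, ← hm]; rfl
    rw [hN.cls_translate C hgh, hN.cls_translate _ hn, hN.cls_translate C hm]
    simp only [natVec_add, map_sub, map_add]
    abel)

theorem existsUnique_isTorAction (hN : N.IsIrreducibleCritical) : ∃! act, N.IsTorAction act := by
  refine ⟨hN.torAction, (hN.isTorAction_iff _).2 fun g C _ _ h => hN.cls_translate C h,
    fun act h => ?_⟩
  refine MulAction.ext (funext fun g => funext fun C => hN.invLrec_ext ?_)
  obtain ⟨n, n', hn⟩ := N.exists_frac_eq g.1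
  exact ((hN.isTorAction_iff act).1 h g C n n' hn).trans
    (hN.cls_translate C hn).symm

theorem smul_mem_lrecLevel (hN : N.IsIrreducibleCritical) {act : MulAction N.Tor N.InvLrec}
    (h : N.IsTorAction act) (g : N.Tor) {C : N.InvLrec} {m : ℕ} (hC : C.1 ∈ N.LrecLevel m) :
    (act.smul g C).1 ∈ N.LrecLevel m := by
  obtain ⟨n, n', hn⟩ := N.exists_frac_eq g.1
  have h1 := (hN.isTorAction_iff act).1 h g C n n' hn
  rw [← map_add, cls_eq_iff] at h1
  have h2 : N.weight _ = 0 := hN.subgroupIP_le h1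
  have h3 : N.weight _ = 0 := (hN.frac_mem_tor_iff n n').1 (by rw [← hn]; exact g.2)
  rw [weight_sub, weight_add, h3] at h2
  rw [hN.mem_lrecLevel_iff_coord, hN.lvl_coord] at hC ⊢
  linarith

/-- A translation in a group is determined by its effect on one point. -/
theorem eq_of_smul_eq (hN : N.IsIrreducibleCritical) {act : MulAction N.Tor N.InvLrec}
    (h : N.IsTorAction act) {g g' : N.Tor} {C : N.InvLrec} (hg : act.smul g C = act.smul g' C) :
    g = g' := by
  obtain ⟨n, n', hn⟩ := N.exists_frac_eq g.1
  obtain ⟨m, m', hm⟩ := N.exists_frac_eq g'.1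
  have h1 := (hN.isTorAction_iff act).1 h g C n n' hn
  have h2 := (hN.isTorAction_iff act).1 h g' C m m' hm
  rw [hg, h2, add_right_inj, ← hN.frac_eq_frac_iff] at h1
  exact Subtype.ext (by rw [hn, hm, h1])

theorem exists_smul_eq (hN : N.IsIrreducibleCritical) {act : MulAction N.Tor N.InvLrec}
    (h : N.IsTorAction act) {C C' : N.InvLrec} {m : ℕ} (hC : C.1 ∈ N.LrecLevel m)
    (hC' : C'.1 ∈ N.LrecLevel m) : ∃ g : N.Tor, act.smul g C = C' := by
  rw [hN.mem_lrecLevel_iff_coord, hN.lvl_coord] at hC hC'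
  -- Equal levels mean equal weights of the coordinates, so their difference defines a torsion
  -- element.
  have hz : hN.coord C'.1 - hN.coord C.1 ∈ N.zeroWeight := by
    change N.weight _ = 0
    rw [weight_sub]
    linarith
  refine ⟨⟨N.frac (posPart (hN.coord C'.1 - hN.coord C.1)) (negPart _), by
    rwa [hN.frac_mem_tor_iff, natVec_posPart_sub]⟩, hN.invLrec_ext ?_⟩
  rw [(hN.isTorAction_iff act).1 h _ C _ _ rfl, natVec_posPart_sub, ← map_add, add_sub_cancel]

end IsIrreducibleCritical

end

end AbelianNetwork

theorem mainTheorem2 {V : Type*} [Fintype V] [DecidableEq V]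
    {E : V → V → Type*} [∀ v u, Fintype (E v u)]
    {A : V → Type*} [∀ v, Fintype (A v)] [∀ v, DecidableEq (A v)]
    {S : V → Type*} [∀ v, Fintype (S v)] [∀ v, Nonempty (S v)]
    (N : AbelianNetwork V E A S)
    (hirr : N.LocallyIrreducible) (hconn : N.StronglyConnected) (hcrit : N.Critical) :
    -- (i) `φ` induces an isomorphism of `ℤ^A_0 / (I - P) K` onto the torsion group
    (N.subgroupIP ≤ N.zeroWeight ∧
      ∃ f : (N.zeroWeight ⧸ N.subgroupIP.addSubgroupOf N.zeroWeight) ≃+ Additive N.Tor,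
        ∀ (n n' : AbelianNetwork.Letter A → ℕ)
          (h : AbelianNetwork.natVec n - AbelianNetwork.natVec n' ∈ N.zeroWeight),
          ((f (QuotientAddGroup.mk ⟨_, h⟩)).toMul : N.Grt) = N.frac n n') ∧
    -- (ii) the invertible recurrent components are those of unstoppable level
    ({C : N.Lrec | N.Invertible C} = (⋃ m ∈ {m : ℕ | m ∉ N.Stop}, N.LrecLevel m) ∧
      Pairwise fun m m' => Disjoint (N.LrecLevel m) (N.LrecLevel m')) ∧
    -- (iii) the torsion group acts freely and transitively on each unstoppable level
    ((∃! act, N.IsTorAction act) ∧ N.Stop.Finite ∧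
      ∀ act, N.IsTorAction act → ∀ m : ℕ, m ∉ N.Stop →
        (N.LrecLevel m).Nonempty ∧
        (∀ (g : N.Tor) (C : N.InvLrec), C.1 ∈ N.LrecLevel m → (act.smul g C).1 ∈ N.LrecLevel m) ∧
        (∀ (g h : N.Tor) (C : N.InvLrec), C.1 ∈ N.LrecLevel m →
          act.smul g C = act.smul h C → g = h) ∧
        (∀ C C' : N.InvLrec, C.1 ∈ N.LrecLevel m → C'.1 ∈ N.LrecLevel m →
          ∃ g : N.Tor, act.smul g C = C')) := by
  have hN : N.IsIrreducibleCritical := ⟨hirr, hconn, hcrit⟩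
  obtain ⟨f, hf⟩ := hN.exists_tor_equiv
  refine ⟨⟨hN.subgroupIP_le, f, fun n n' h => by rw [hf]; exact hN.toTor_eq n n' h⟩,
    ⟨hN.setOf_invertible_eq, hN.pairwise_disjoint_lrecLevel⟩,
    hN.existsUnique_isTorAction, hN.finite_stop, fun act hact m hm => ?_⟩
  exact ⟨hN.nonempty_lrecLevel hm, fun g C hC => hN.smul_mem_lrecLevel hact g hC,
    fun g h C _ heq => hN.eq_of_smul_eq hact heq,
    fun C C' hC hC' => hN.exists_smul_eq hact hC hC'⟩
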